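/- Let $k \ge 0$ and let $\Lambda$ be a $k$-graph, i.e. a nonempty countable small category with a degree functor $d : \Lambda \to \mathbb{N}^k$ such that whenever $d(\lambda) = m+n$ there are unique $\mu,\nu$ with $d(\mu)=m$, $d(\nu)=n$ and $\lambda = \mu\nu$. Write $\Lambda^n = d^{-1}(n)$, identify $\Lambda^0$ with the set of objects, let $r(\lambda), s(\lambda) \in \Lambda^0$ be the codomain and domain of $\lambda$, and put $v\Lambda^n = \{\lambda\in\Lambda^n : r(\lambda)=v\}$, $\Lambda^n v = \{\lambda\in\Lambda^n : s(\lambda)=v\}$. Suppose that $\Lambda$ is row-finite with no sources: every $v\Lambda^n$ is finite and nonempty. For a normalised categorical 2-cocycle $c$ on $\Lambda$ with values in $\mathbb{T}$ (so $c(\lambda_1,\lambda_2)c(\lambda_1\lambda_2,\lambda_3) = c(\lambda_2,\lambda_3)c(\lambda_1,\lambda_2\lambda_3)$, and $c(\lambda_1,\lambda_2)=1$ if $\lambda_1$ or $\lambda_2$ is a vertex), a Cuntz–Krieger $(\Lambda,c)$-family in a $C^*$-algebra $B$ is a map $t : \Lambda \to B$, $\lambda\mapsto t_\lambda$, such that (CK1)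 the $t_v$, $v\in\Lambda^0$, are mutually orthogonal projections; (CK2) $t_\mu t_\nu = c(\mu,\nu)t_{\mu\nu}$ whenever $s(\mu)=r(\nu)$; (CK3) $t_\lambda^*t_\lambda = t_{s(\lambda)}$; (CK4) $t_v = \sum_{\lambda\in v\Lambda^n} t_\lambda t_\lambda^*$ for all $v\in\Lambda^0$, $n\in\mathbb{N}^k$. Let $C^*(\Lambda,c)$ be the $C^*$-algebra generated by a universal such family $s$, let $\pi_t : C^*(\Lambda,c)\to B$ be the homomorphism with $\pi_t(s_\lambda)=t_\lambda$ induced by a family $t$, let $\gamma$ be the gauge action of $\mathbb{T}^k$, given by $\gamma_z(s_\lambda)=z^{d(\lambda)}s_\lambda$, and let $C^*(\Lambda,c)^\gamma$ be its fixed-point algebra. For a countable set $X$ let $\mathcal{K}_X \cong \mathcal{K}(\ell^2(X))$ be the $C^*$-algebra generated by matrix units $\{\theta_{x,y} : x,y\in X\}$. Then: 1. For every $c$ and every $n\in\mathbb{N}^k$, $\overline{\operatorname{span}}\{s_\mu s_\nu^* : \mu,\nu\in\Lambda^n\}$ is a $C^*$-subalgebra of $C^*(\Lambda,c)^\gamma$,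 and there is a unique isomorphism $$\overline{\operatorname{span}}\{s_\mu s_\nu^* : \mu,\nu\in\Lambda^n\} \cong \bigoplus_{v\in\Lambda^0}\mathcal{K}_{\Lambda^n v}$$ ($c_0$-direct sum) that sends $s_\mu s_\nu^*$ to $\theta_{\mu,\nu}$ in the summand of $v$ whenever $\mu,\nu\in\Lambda^n v$. 2. For every $c$ and all $m\le n$ in $\mathbb{N}^k$, $\overline{\operatorname{span}}\{s_\mu s_\nu^* : \mu,\nu\in\Lambda^m\}\subseteq\overline{\operatorname{span}}\{s_\mu s_\nu^* : \mu,\nu\in\Lambda^n\}$. Moreover $$C^*(\Lambda,c)^\gamma = \overline{\bigcup_{n\in\mathbb{N}^k}\operatorname{span}\{s_\mu s_\nu^* : \mu,\nu\in\Lambda^n\}},$$ and this algebra is AF: it is the closure of the union of an increasing sequence of finite-dimensional $*$-subalgebras. 3. For every $c$ and every Cuntz–Krieger $(\Lambda,c)$-family $t$ in a $C^*$-algebra, the restriction of $\pi_t$ to $C^*(\Lambda,c)^\gamma$ is injective if and only if $t_v\neq 0$ for every $v\in\Lambda^0$. 4. For any two cocycles $c_1,c_2$, the fixed-point algebras $C^*(\Lambda,c_1)^\gamma$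 and $C^*(\Lambda,c_2)^\gamma$ are isomorphic. -/

import Mathlib

open CategoryTheory Filter Topology
open scoped ENNReal

universe u v w

noncomputable section

/-! ### Higher-rank graphs and their categorical 2-cocycles -/

/-- A `k`-graph: a nonempty countable small category with a degree functor to `ℕᵏ` (written as a
function on morphisms) that has the unique factorisation property.

A morphism `l : a ⟶ b` is a path with source `s(l) = a` and range `r(l) = b`; the product `μν` of
paths with `s(μ) = r(ν)` is the composite `μ ∘ ν`, that is, `ν ≫ μ` in the notation of Mathlib.
Vertices (paths of degree `0`) are identified with the objects through `v ↦ 𝟙 v`. -/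
structure KGraph (k : ℕ) where
  Obj : Type u
  [category : SmallCategory Obj]
  [nonempty : Nonempty Obj]
  [countable_obj : Countable Obj]
  [countable_hom : ∀ a b : Obj, Countable (a ⟶ b)]
  deg : ∀ ⦃a b : Obj⦄, (a ⟶ b) → (Fin k → ℕ)
  deg_id : ∀ a : Obj, deg (𝟙 a) = 0
  deg_mul : ∀ ⦃a b e : Obj⦄ (μ : b ⟶ a) (ν : e ⟶ b), deg (ν ≫ μ) = deg μ + deg ν
  factorisation : ∀ ⦃a e : Obj⦄ (l : e ⟶ a) (m n : Fin k → ℕ), deg l = m + n →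
    ∃! p : Σ b : Obj, (b ⟶ a) × (e ⟶ b), deg p.2.1 = m ∧ deg p.2.2 = n ∧ p.2.2 ≫ p.2.1 = l

attribute [instance] KGraph.category KGraph.nonempty KGraph.countable_obj KGraph.countable_hom

namespace KGraph

variable {k : ℕ}

/-- `Λⁿ`: the paths of degree `n`. -/
def Path (Λ : KGraph.{u} k) (n : Fin k → ℕ) : Type u :=
  Σ (a b : Λ.Obj), {l : a ⟶ b // Λ.deg l = n}

/-- `v Λⁿ`: the paths of degree `n` with range `v`. -/
def PathTo (Λ : KGraph.{u} k) (v : Λ.Obj) (n : Fin k → ℕ) : Type u :=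
  Σ a : Λ.Obj, {l : a ⟶ v // Λ.deg l = n}

/-- `Λⁿ v`: the paths of degree `n` with source `v`. -/
def PathFrom (Λ : KGraph.{u} k) (n : Fin k → ℕ) (v : Λ.Obj) : Type u :=
  Σ b : Λ.Obj, {l : v ⟶ b // Λ.deg l = n}

/-- `Λ` is row-finite: every `v Λⁿ` is finite. -/
class RowFinite (Λ : KGraph.{u} k) : Prop where
  finite_pathTo : ∀ (v : Λ.Obj) (n : Fin k → ℕ), Finite (Λ.PathTo v n)

/-- `Λ` has no sources: every `v Λⁿ` is nonempty. -/
class NoSources (Λ : KGraph.{u} k) : Prop where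
  nonempty_pathTo : ∀ (v : Λ.Obj) (n : Fin k → ℕ), Nonempty (Λ.PathTo v n)

instance (Λ : KGraph.{u} k) [Λ.RowFinite] (v : Λ.Obj) (n : Fin k → ℕ) :
    Fintype (Λ.PathTo v n) :=
  haveI := RowFinite.finite_pathTo v n
  Fintype.ofFinite _

/-- The normalised categorical 2-cocycles on `Λ` with values in the circle group `𝕋`. -/
structure TwoCocycle (Λ : KGraph.{u} k) where
  toFun : ∀ ⦃a b e : Λ.Obj⦄, (b ⟶ a) → (e ⟶ b) → Circle
  id_left : ∀ ⦃a e : Λ.Obj⦄ (ν : e ⟶ a), toFun (𝟙 a) ν = 1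
  id_right : ∀ ⦃a e : Λ.Obj⦄ (μ : e ⟶ a), toFun μ (𝟙 e) = 1
  cocycle : ∀ ⦃a b e f : Λ.Obj⦄ (l₁ : b ⟶ a) (l₂ : e ⟶ b) (l₃ : f ⟶ e),
    toFun l₁ l₂ * toFun (l₂ ≫ l₁) l₃ = toFun l₂ l₃ * toFun l₁ (l₃ ≫ l₂)

instance (Λ : KGraph.{u} k) : CoeFun Λ.TwoCocycle
    (fun _ => ∀ ⦃a b e : Λ.Obj⦄, (b ⟶ a) → (e ⟶ b) → Circle) :=
  ⟨TwoCocycle.toFun⟩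

/-- A Cuntz–Krieger `(Λ,c)`-family `l ↦ t l` in a C⋆-algebra `B`. -/
structure CKFamily {Λ : KGraph.{u} k} [Λ.RowFinite] (c : Λ.TwoCocycle)
    (B : Type w) [NonUnitalCStarAlgebra B] where
  toFun : ∀ ⦃a b : Λ.Obj⦄, (a ⟶ b) → B
  ck1_proj : ∀ v : Λ.Obj, IsStarProjection (toFun (𝟙 v))
  ck1_orth : ∀ v w : Λ.Obj, v ≠ w → toFun (𝟙 v) * toFun (𝟙 w) = 0
  ck2 : ∀ ⦃a b e : Λ.Obj⦄ (μ : b ⟶ a) (ν : e ⟶ b),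
    toFun μ * toFun ν = (c μ ν : ℂ) • toFun (ν ≫ μ)
  ck3 : ∀ ⦃a b : Λ.Obj⦄ (l : a ⟶ b), star (toFun l) * toFun l = toFun (𝟙 a)
  ck4 : ∀ (v : Λ.Obj) (n : Fin k → ℕ),
    toFun (𝟙 v) = ∑ p : Λ.PathTo v n, toFun p.2.1 * star (toFun p.2.1)

section families

variable {Λ : KGraph.{u} k} [Λ.RowFinite] {c : Λ.TwoCocycle}

instance (B : Type w) [NonUnitalCStarAlgebra B] :
    CoeFun (CKFamily c B) (fun _ => ∀ ⦃a b : Λ.Obj⦄, (a ⟶ b) → B) :=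
  ⟨CKFamily.toFun⟩

namespace CKFamily

theorem norm_le_one {B : Type w} [NonUnitalCStarAlgebra B] (t : CKFamily c B)
    {a b : Λ.Obj} (l : a ⟶ b) : ‖t l‖ ≤ 1 := by
  have h1 : ‖t l‖ * ‖t l‖ ≤ 1 := by
    rw [← CStarRing.norm_star_mul_self, t.ck3]
    exact IsStarProjection.norm_le _ (t.ck1_proj a)
  nlinarith [norm_nonneg (t l)]

/-- The image of a Cuntz–Krieger family under a ⋆-homomorphism. -/
def map {B : Type v} {D : Type w} [NonUnitalCStarAlgebra B] [NonUnitalCStarAlgebra D]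
    (t : CKFamily c B) (φ : B →⋆ₙₐ[ℂ] D) : CKFamily c D where
  toFun a b l := φ (t l)
  ck1_proj v := (t.ck1_proj v).map φ
  ck1_orth v w h := by rw [← map_mul, t.ck1_orth v w h, map_zero]
  ck2 a b e μ ν := by rw [← map_mul, t.ck2, map_smul]
  ck3 a b l := by rw [← map_star, ← map_mul, t.ck3]
  ck4 v n := by rw [t.ck4 v n, map_sum]; simp only [map_mul, map_star]

/-- A Cuntz–Krieger family in `B` whose members lie in a closed ⋆-subalgebra `S`, viewed in `S`. -/
def codRestrict {B : Type w} [NonUnitalCStarAlgebra B] (t : CKFamily c B)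
    (S : NonUnitalStarSubalgebra ℂ B) [IsClosed (S : Set B)]
    (h : ∀ ⦃a b : Λ.Obj⦄ (l : a ⟶ b), t l ∈ S) : CKFamily c S where
  toFun a b l := ⟨t l, h l⟩
  ck1_proj v := ⟨Subtype.ext (t.ck1_proj v).1, Subtype.ext (t.ck1_proj v).2⟩
  ck1_orth v w h := Subtype.ext (t.ck1_orth v w h)
  ck2 a b e μ ν := Subtype.ext (t.ck2 μ ν)
  ck3 a b l := Subtype.ext (t.ck3 l)
  ck4 v n := Subtype.ext (by
    rw [AddSubmonoidClass.coe_finsetSum]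
    exact t.ck4 v n)

/-- The family `l ↦ z^{d(l)} t_l`, for `z ∈ 𝕋ᵏ`. -/
def twist {B : Type w} [NonUnitalCStarAlgebra B] (t : CKFamily c B) (z : Fin k → Circle) :
    CKFamily c B where
  toFun a b l := ((∏ i, z i ^ Λ.deg l i : Circle) : ℂ) • t l
  ck1_proj v := by simpa [Λ.deg_id] using t.ck1_proj v
  ck1_orth v w h := by simpa [Λ.deg_id] using t.ck1_orth v w h
  ck2 a b e μ ν := by
    rw [smul_mul_smul_comm, t.ck2, smul_smul, smul_smul, Λ.deg_mul, ← Circle.coe_mul,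
      ← Circle.coe_mul, ← Circle.coe_mul]
    simp only [Pi.add_apply, pow_add, Finset.prod_mul_distrib]
    congr 2
    exact mul_comm _ _
  ck3 a b l := by
    rw [star_smul, smul_mul_smul_comm, t.ck3, Λ.deg_id]
    simp only [RCLike.star_def, ← Circle.coe_inv_eq_conj, ← Circle.coe_mul]
    simp
  ck4 v n := by
    rw [Λ.deg_id]
    simp only [star_smul, smul_mul_smul_comm, RCLike.star_def, ← Circle.coe_inv_eq_conj,
      ← Circle.coe_mul]
    simpa using t.ck4 v n

end CKFamily

end families

end KGraph

/-! ### The universal C⋆-algebra of the Cuntz–Krieger relations -/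

/-- A C⋆-algebra structure moved along a bijection. -/
abbrev Equiv.nonUnitalCStarAlgebra {X : Type v} {D : Type w} [NonUnitalCStarAlgebra D]
    (e : X ≃ D) : NonUnitalCStarAlgebra X :=
  letI r : NonUnitalRing X := e.nonUnitalRing
  letI m : Module ℂ X := e.module ℂ
  letI st : StarRing X := e.starRing
  letI f : X →ₙ+* D := { e.ringEquiv with map_zero' := e.ringEquiv.map_zero }
  letI nr : NonUnitalNormedRing X := NonUnitalNormedRing.induced X D f e.injective
  haveI hs : ∀ (a : ℂ) (x : X), e (a • x) = a • e x := fun a x => e.apply_symm_apply _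
  haveI hst : ∀ x : X, e (star x) = star (e x) := fun x => e.apply_symm_apply _
  haveI hm : ∀ x y : X, e (x * y) = e x * e y := fun x y => e.apply_symm_apply _
  haveI hi : Isometry e := fun x y => rfl
  { nr, st, m with
    complete := ((hi.isUniformInducing.completeSpace_congr e.surjective).2 inferInstance).complete
    norm_mul_self_le := fun x => by
      change ‖e x‖ * ‖e x‖ ≤ ‖e (star x * x)‖
      rw [hm, hst, CStarRing.norm_star_mul_self]
    norm_smul_le := fun a x => by
      change ‖e (a • x)‖ ≤ ‖a‖ * ‖e x‖
      rw [hs, norm_smul]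
    smul_assoc := fun a x y => e.injective (by
      simp only [smul_eq_mul, hs, hm, smul_mul_assoc])
    smul_comm := fun a x y => e.injective (by
      simp only [smul_eq_mul, hs, hm, mul_smul_comm])
    star_smul := fun a x => e.injective (by
      simp only [hs, hst, star_smul]) }

/-- A C⋆-algebra whose structure is moved along `e` is isomorphic to the original one. -/
def Equiv.nonUnitalCStarAlgebraIso {X : Type v} {D : Type w} [NonUnitalCStarAlgebra D]
    (e : X ≃ D) :
    letI := e.nonUnitalCStarAlgebra
    X ≃⋆ₐ[ℂ] D :=
  letI := e.nonUnitalCStarAlgebra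
  { e with
    map_mul' := fun _ _ => e.apply_symm_apply _
    map_add' := fun _ _ => e.apply_symm_apply _
    map_star' := fun _ => e.apply_symm_apply _
    map_smul' := fun _ _ => e.apply_symm_apply _ }

section separability

variable {B : Type w} [NonUnitalCStarAlgebra B]

theorem Subsemigroup.countable_closure_of_countable {S : Set B} (hS : S.Countable) :
    (Subsemigroup.closure S : Set B).Countable := by
  have := hS.to_subtype
  let f : S × List S → B := fun p => (p.2.map Subtype.val).foldl (· * ·) p.1
  have key : ∀ (l : List B) (a b : B), a * l.foldl (· * ·) b = l.foldl (· * ·) (a * b) := by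
    intro l
    induction l with
    | nil => intro a b; rfl
    | cons x l ih => intro a b; simp only [List.foldl_cons, ih, mul_assoc]
  let T : Subsemigroup B :=
    { carrier := Set.range f
      mul_mem' := by
        rintro _ _ ⟨p, rfl⟩ ⟨q, rfl⟩
        refine ⟨(p.1, p.2 ++ q.1 :: q.2), ?_⟩
        simp only [f, List.map_append, List.map_cons, List.foldl_append, List.foldl_cons, key] }
  have hT : Subsemigroup.closure S ≤ T :=
    Subsemigroup.closure_le.2 fun x hx => ⟨(⟨x, hx⟩, []), rfl⟩
  exact (Set.countable_range f).mono hT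

theorem NonUnitalStarAlgebra.isSeparable_closure_adjoin {S : Set B} (hS : S.Countable) :
    TopologicalSpace.IsSeparable
      ((NonUnitalStarAlgebra.adjoin ℂ S).topologicalClosure : Set B) := by
  have h1 : (NonUnitalStarAlgebra.adjoin ℂ S : Set B)
      = (Submodule.span ℂ (Subsemigroup.closure (S ∪ star S) : Set B) : Set B) :=
    congrArg (fun M : Submodule ℂ B => (M : Set B)) (NonUnitalStarAlgebra.adjoin_eq_span S)
  have h2 : (star S).Countable := by
    rw [← Set.image_star]
    exact hS.image _
  have h3 := ((Subsemigroup.countable_closure_of_countable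
    (hS.union h2)).isSeparable.span (R := ℂ)).closure
  rw [← h1] at h3
  exact h3

end separability

/-- A second countable `T₀` space embeds (as a set) in the power set of `ℕ`. -/
theorem exists_injective_set_nat (X : Type w) [TopologicalSpace X] [T0Space X]
    [SecondCountableTopology X] : ∃ f : X → Set ℕ, Function.Injective f := by
  obtain ⟨b, hb, -, hB⟩ := TopologicalSpace.exists_countable_basis X
  obtain ⟨g, hg⟩ := Set.countable_iff_exists_injOn.1 hb
  refine ⟨fun x => g '' {s ∈ b | x ∈ s}, fun x y h => ?_⟩
  apply Inseparable.eq
  rw [hB.inseparable_iff]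
  intro s hs
  have : ∀ z, g s ∈ g '' {s ∈ b | z ∈ s} ↔ z ∈ s := by
    intro z
    constructor
    · rintro ⟨s', ⟨h1, h2⟩, h3⟩
      rwa [← hg h1 hs h3]
    · exact fun hz => ⟨s, ⟨hs, hz⟩, rfl⟩
  rw [← this x, ← this y, show g '' {s ∈ b | x ∈ s} = g '' {s ∈ b | y ∈ s} from h]

namespace KGraph

variable {k : ℕ} {Λ : KGraph.{u} k} [Λ.RowFinite]

/-- A Cuntz–Krieger `(Λ,c)`-family in a C⋆-algebra whose underlying set is a subset of the power
set of `ℕ`. A C⋆-algebra generated by a Cuntz–Krieger family is separable, so has at most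
continuum many elements, and is isomorphic to one of these. Hence these families form a set that
represents all Cuntz–Krieger families up to isomorphism. -/
structure SmallFamily (c : Λ.TwoCocycle) where
  carrier : Set (Set ℕ)
  algebra : NonUnitalCStarAlgebra carrier
  family : CKFamily c carrier

/-- The C⋆-algebra in which a `SmallFamily` lives. -/
def SmallFamily.Alg {c : Λ.TwoCocycle} (R : SmallFamily c) : Type := R.carrier

instance {c : Λ.TwoCocycle} (R : SmallFamily c) : NonUnitalCStarAlgebra R.Alg := R.algebra

/-- The family of a `SmallFamily`, as a family in `R.Alg`. -/
def SmallFamily.fam {c : Λ.TwoCocycle} (R : SmallFamily c) : CKFamily c R.Alg := R.family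

/-- The direct product of all Cuntz–Krieger families, in the `ℓ^∞`-product of their algebras. -/
def productFamily (c : Λ.TwoCocycle) :
    CKFamily c (lp (fun R : SmallFamily c => R.Alg) ∞) where
  toFun a b l := ⟨fun R => R.fam l, memℓp_infty ⟨1, by
    rintro _ ⟨R, rfl⟩
    exact R.fam.norm_le_one l⟩⟩
  ck1_proj v := ⟨lp.ext (funext fun R => (R.fam.ck1_proj v).1),
    lp.ext (funext fun R => (R.fam.ck1_proj v).2)⟩
  ck1_orth v w h := lp.ext (funext fun R => R.fam.ck1_orth v w h)
  ck2 a b e μ ν := lp.ext (funext fun R => R.fam.ck2 μ ν)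
  ck3 a b l := lp.ext (funext fun R => R.fam.ck3 l)
  ck4 v n := lp.ext (funext fun R => by
    rw [lp.coeFn_sum, Finset.sum_apply]
    exact R.fam.ck4 v n)

/-- The set of members of a family. -/
def CKFamily.range {c : Λ.TwoCocycle} {B : Type w} [NonUnitalCStarAlgebra B]
    (t : CKFamily c B) : Set B :=
  {x | ∃ (a b : Λ.Obj) (l : a ⟶ b), x = t l}

/-- `C*(t)`: the C⋆-subalgebra generated by a Cuntz–Krieger family. -/
def CKFamily.generated {c : Λ.TwoCocycle} {B : Type w} [NonUnitalCStarAlgebra B]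
    (t : CKFamily c B) : NonUnitalStarSubalgebra ℂ B :=
  (NonUnitalStarAlgebra.adjoin ℂ t.range).topologicalClosure

instance {c : Λ.TwoCocycle} {B : Type w} [NonUnitalCStarAlgebra B] (t : CKFamily c B) :
    IsClosed (t.generated : Set B) :=
  NonUnitalStarSubalgebra.isClosed_topologicalClosure _

theorem CKFamily.mem_generated {c : Λ.TwoCocycle} {B : Type w} [NonUnitalCStarAlgebra B]
    (t : CKFamily c B) ⦃a b : Λ.Obj⦄ (l : a ⟶ b) : t l ∈ t.generated :=
  NonUnitalStarSubalgebra.le_topologicalClosure _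
    (NonUnitalStarAlgebra.subset_adjoin ℂ _ ⟨a, b, l, rfl⟩)

theorem CKFamily.countable_range {c : Λ.TwoCocycle} {B : Type w} [NonUnitalCStarAlgebra B]
    (t : CKFamily c B) : t.range.Countable := by
  have : t.range = Set.range (fun p : Σ (a b : Λ.Obj), (a ⟶ b) => t p.2.2) := by
    ext x
    constructor
    · rintro ⟨a, b, l, rfl⟩
      exact ⟨⟨a, b, l⟩, rfl⟩
    · rintro ⟨⟨a, b, l⟩, rfl⟩
      exact ⟨a, b, l, rfl⟩
  rw [this]
  exact Set.countable_range _

theorem CKFamily.generated_hom_ext {c : Λ.TwoCocycle} {B : Type v} {D : Type w}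
    [NonUnitalCStarAlgebra B] [NonUnitalCStarAlgebra D] (t : CKFamily c B)
    (φ ψ : t.generated →⋆ₙₐ[ℂ] D)
    (h : ∀ ⦃a b : Λ.Obj⦄ (l : a ⟶ b),
      φ ⟨t l, t.mem_generated l⟩ = ψ ⟨t l, t.mem_generated l⟩) : φ = ψ := by
  have cont : ∀ φ : t.generated →⋆ₙₐ[ℂ] D, Continuous φ := fun φ =>
    AddMonoidHomClass.continuous_of_bound φ 1
      (by simpa only [one_mul] using! NonUnitalStarAlgHom.norm_apply_le φ)
  let E : NonUnitalStarSubalgebra ℂ B := (NonUnitalStarAlgHom.equalizer φ ψ).map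
    (NonUnitalStarSubalgebraClass.subtype t.generated)
  have hE : IsClosed (E : Set B) := by
    have h1 : IsClosed {x : t.generated | φ x = ψ x} := isClosed_eq (cont φ) (cont ψ)
    have h2 : IsClosed (t.generated : Set B) := inferInstance
    exact h2.isClosedEmbedding_subtypeVal.isClosedMap _ h1
  have hle : t.generated ≤ E := by
    refine NonUnitalStarSubalgebra.topologicalClosure_minimal _ ?_ hE
    refine NonUnitalStarAlgebra.adjoin_le ?_
    rintro _ ⟨a, b, l, rfl⟩
    exact ⟨⟨t l, t.mem_generated l⟩, h l, rfl⟩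
  refine NonUnitalStarAlgHom.ext fun x => ?_
  obtain ⟨y, hy, hyx⟩ := hle x.2
  rw [← show y = x from Subtype.ext hyx]
  exact hy

/-- The twisted `k`-graph C⋆-algebra `C*(Λ,c)`. Its universal property is `existsUnique_lift`. -/
def CStar (c : Λ.TwoCocycle) : Type u := (productFamily c).generated

instance (c : Λ.TwoCocycle) : NonUnitalCStarAlgebra (CStar c) :=
  inferInstanceAs (NonUnitalCStarAlgebra (productFamily c).generated)

/-- The universal Cuntz–Krieger family `s` in `C*(Λ,c)`. -/
def univ (c : Λ.TwoCocycle) : CKFamily c (CStar c) :=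
  (productFamily c).codRestrict (productFamily c).generated (productFamily c).mem_generated

/-- Two ⋆-homomorphisms on `C*(Λ,c)` that agree on the generators are equal. -/
theorem CStar.hom_ext {c : Λ.TwoCocycle} {B : Type w} [NonUnitalCStarAlgebra B]
    {φ ψ : CStar c →⋆ₙₐ[ℂ] B}
    (h : ∀ ⦃a b : Λ.Obj⦄ (l : a ⟶ b), φ (univ c l) = ψ (univ c l)) : φ = ψ :=
  (productFamily c).generated_hom_ext φ ψ h

/-- The universal property of `C*(Λ,c)`. -/
theorem existsUnique_lift {c : Λ.TwoCocycle} {B : Type w} [NonUnitalCStarAlgebra B]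
    (t : CKFamily c B) :
    ∃! π : CStar c →⋆ₙₐ[ℂ] B, ∀ ⦃a b : Λ.Obj⦄ (l : a ⟶ b), π (univ c l) = t l := by
  refine existsUnique_of_exists_of_unique ?_ fun φ ψ hφ hψ =>
    CStar.hom_ext fun a b l => (hφ l).trans (hψ l).symm
  have sep : TopologicalSpace.IsSeparable (t.generated : Set B) :=
    NonUnitalStarAlgebra.isSeparable_closure_adjoin t.countable_range
  have := sep.separableSpace
  have : SecondCountableTopology t.generated :=
    UniformSpace.secondCountable_of_separable t.generated
  obtain ⟨f, hf⟩ := exists_injective_set_nat t.generated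
  let e : Set.range f ≃ t.generated := (Equiv.ofInjective f hf).symm
  let _ := e.nonUnitalCStarAlgebra
  let i : Set.range f ≃⋆ₐ[ℂ] t.generated := e.nonUnitalCStarAlgebraIso
  let t' : CKFamily c t.generated := t.codRestrict t.generated t.mem_generated
  let R : SmallFamily c := ⟨Set.range f, inferInstance, t'.map i.symm.toNonUnitalStarAlgHom⟩
  let ev : CStar c →⋆ₙₐ[ℂ] R.Alg :=
    { toFun := fun x => x.1.1 R
      map_smul' := fun _ _ => rfl
      map_zero' := rfl
      map_add' := fun _ _ => rfl
      map_mul' := fun _ _ => rfl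
      map_star' := fun _ => rfl }
  let j : R.Alg →⋆ₙₐ[ℂ] t.generated := i.toNonUnitalStarAlgHom
  refine ⟨((NonUnitalStarSubalgebraClass.subtype t.generated).comp j).comp ev,
    fun a b l => ?_⟩
  change ((i (i.symm (t' l)) : t.generated) : B) = t l
  rw [StarAlgEquiv.apply_symm_apply]
  rfl

/-- The homomorphism `π_t : C*(Λ,c) → B` induced by a Cuntz–Krieger family `t` in `B`. -/
def lift {c : Λ.TwoCocycle} {B : Type w} [NonUnitalCStarAlgebra B] (t : CKFamily c B) :
    CStar c →⋆ₙₐ[ℂ] B :=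
  (existsUnique_lift t).choose

theorem lift_univ {c : Λ.TwoCocycle} {B : Type w} [NonUnitalCStarAlgebra B]
    (t : CKFamily c B) ⦃a b : Λ.Obj⦄ (l : a ⟶ b) : lift t (univ c l) = t l :=
  (existsUnique_lift t).choose_spec.1 l

/-! ### The gauge action and its fixed-point algebra -/

theorem lift_twist_comp (c : Λ.TwoCocycle) (z w : Fin k → Circle) :
    (lift ((univ c).twist z)).comp (lift ((univ c).twist w)) = lift ((univ c).twist (z * w)) := by
  refine CStar.hom_ext fun a b l => ?_
  rw [NonUnitalStarAlgHom.comp_apply, lift_univ, lift_univ]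
  change lift _ (((∏ i, w i ^ Λ.deg l i : Circle) : ℂ) • univ c l)
    = ((∏ i, (z * w) i ^ Λ.deg l i : Circle) : ℂ) • univ c l
  rw [map_smul, lift_univ]
  change _ • (((∏ i, z i ^ Λ.deg l i : Circle) : ℂ) • univ c l) = _
  rw [smul_smul, ← Circle.coe_mul, ← Finset.prod_mul_distrib]
  simp only [Pi.mul_apply, mul_pow, mul_comm]

theorem lift_twist_one (c : Λ.TwoCocycle) :
    lift ((univ c).twist 1) = NonUnitalStarAlgHom.id ℂ (CStar c) := by
  refine CStar.hom_ext fun a b l => ?_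
  rw [lift_univ]
  change ((∏ i, (1 : Fin k → Circle) i ^ Λ.deg l i : Circle) : ℂ) • univ c l = univ c l
  simp

/-- The gauge action `γ` of `𝕋ᵏ` on `C*(Λ,c)`, determined by `γ_z(s_l) = z^{d(l)} s_l`. -/
def gauge (c : Λ.TwoCocycle) : (Fin k → Circle) →* (CStar c ≃⋆ₐ[ℂ] CStar c) where
  toFun z := StarAlgEquiv.ofNonUnitalStarAlgHom (lift ((univ c).twist z))
    (lift ((univ c).twist z⁻¹))
    (by rw [lift_twist_comp, inv_mul_cancel, lift_twist_one])
    (by rw [lift_twist_comp, mul_inv_cancel, lift_twist_one])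
  map_one' := StarAlgEquiv.ext fun x => DFunLike.congr_fun (lift_twist_one c) x
  map_mul' z w := StarAlgEquiv.ext fun x => (DFunLike.congr_fun (lift_twist_comp c z w) x).symm

theorem gauge_univ (c : Λ.TwoCocycle) (z : Fin k → Circle) ⦃a b : Λ.Obj⦄ (l : a ⟶ b) :
    gauge c z (univ c l) = ((∏ i, z i ^ Λ.deg l i : Circle) : ℂ) • univ c l :=
  lift_univ _ l

/-- `C*(Λ,c)^γ`: the fixed-point algebra of the gauge action. -/
def fixedPoints (c : Λ.TwoCocycle) : NonUnitalStarSubalgebra ℂ (CStar c) where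
  carrier := {x | ∀ z, gauge c z x = x}
  add_mem' hx hy z := by rw [map_add, hx z, hy z]
  zero_mem' z := map_zero _
  mul_mem' hx hy z := by rw [map_mul, hx z, hy z]
  smul_mem' r x hx z := by rw [map_smul, hx z]
  star_mem' hx z := by rw [map_star, hx z]

instance (c : Λ.TwoCocycle) : IsClosed (fixedPoints c : Set (CStar c)) := by
  have : (fixedPoints c : Set (CStar c)) = ⋂ z, {x | gauge c z x = x} := by
    ext x
    simp only [Set.mem_iInter]
    rfl
  rw [this]
  refine isClosed_iInter fun z => isClosed_eq ?_ continuous_id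
  exact AddMonoidHomClass.continuous_of_bound (gauge c z) 1
    (by simpa only [one_mul] using! NonUnitalStarAlgHom.norm_apply_le (gauge c z))

/-- `span {s_μ s_ν* : μ, ν ∈ Λⁿ}`. -/
def levelSpan (c : Λ.TwoCocycle) (n : Fin k → ℕ) : Submodule ℂ (CStar c) :=
  Submodule.span ℂ {x | ∃ μ ν : Λ.Path n, x = univ c μ.2.2.1 * star (univ c ν.2.2.1)}

end KGraph

/-! ### Compact operators, direct sums and AF algebras -/

section targets

open scoped Classical in
/-- The matrix unit `θ_{x,y}` on `ℓ²(X)`: the operator `e_z ↦ δ_{y,z} e_x`. -/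
def matrixUnit {X : Type u} (x y : X) : lp (fun _ : X => ℂ) 2 →L[ℂ] lp (fun _ : X => ℂ) 2 :=
  InnerProductSpace.rankOne ℂ (lp.single 2 x (1 : ℂ)) (lp.single 2 y (1 : ℂ))

/-- The compact operators on `ℓ²(X)`: the closed ⋆-algebra generated by the matrix units. -/
def compactOperators (X : Type u) :
    NonUnitalStarSubalgebra ℂ (lp (fun _ : X => ℂ) 2 →L[ℂ] lp (fun _ : X => ℂ) 2) :=
  (NonUnitalStarAlgebra.adjoin ℂ {T | ∃ x y : X, T = matrixUnit x y}).topologicalClosure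

instance (X : Type u) : IsClosed (compactOperators X : Set
    (lp (fun _ : X => ℂ) 2 →L[ℂ] lp (fun _ : X => ℂ) 2)) :=
  NonUnitalStarSubalgebra.isClosed_topologicalClosure _

/-- `𝒦_X`: the C⋆-algebra generated by matrix units `θ_{x,y}`, for `x, y ∈ X`, realised as
`𝒦(ℓ²(X))`. -/
def CompactAlgebra (X : Type u) : Type u := compactOperators X

instance (X : Type u) : NonUnitalCStarAlgebra (CompactAlgebra X) :=
  inferInstanceAs (NonUnitalCStarAlgebra (compactOperators X))

/-- The matrix unit `θ_{x,y}` as an element of `𝒦_X`. -/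
def CompactAlgebra.unit {X : Type u} (x y : X) : CompactAlgebra X :=
  (⟨matrixUnit x y, NonUnitalStarSubalgebra.le_topologicalClosure _
    (NonUnitalStarAlgebra.subset_adjoin ℂ _ ⟨x, y, rfl⟩)⟩ : compactOperators X)

variable {I : Type u} (A : I → Type v) [∀ i, NonUnitalCStarAlgebra (A i)]

/-- The bounded families `(aᵢ)` with `aᵢ ∈ Aᵢ` whose norms vanish at infinity. -/
def vanishingFamilies : NonUnitalStarSubalgebra ℂ (lp A ∞) where
  carrier := {f | Tendsto (fun i => ‖f i‖) cofinite (𝓝 0)}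
  add_mem' {f g} hf hg := by
    refine squeeze_zero (fun i => norm_nonneg _) (fun i => norm_add_le (f i) (g i)) ?_
    simpa using Tendsto.add hf hg
  zero_mem' := by
    change Tendsto (fun i : I => ‖(0 : A i)‖) cofinite (𝓝 0)
    simpa using tendsto_const_nhds
  mul_mem' {f g} hf hg := by
    refine squeeze_zero (fun i => norm_nonneg _) (fun i => norm_mul_le (f i) (g i)) ?_
    simpa using Tendsto.mul hf hg
  smul_mem' r f hf := by
    refine squeeze_zero (fun i => norm_nonneg _) (fun i => (norm_smul_le r (f i))) ?_
    simpa using Tendsto.const_mul ‖r‖ hf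
  star_mem' {f} hf := by
    change Tendsto (fun i => ‖star (f i)‖) cofinite (𝓝 0)
    simp only [norm_star]
    exact hf

instance : IsClosed (vanishingFamilies A : Set (lp A ∞)) := by
  refine isClosed_of_closure_subset fun f hf => ?_
  change Tendsto (fun i => ‖f i‖) cofinite (𝓝 0)
  rw [Metric.tendsto_nhds]
  intro ε hε
  obtain ⟨g, hg, hfg⟩ := Metric.mem_closure_iff.1 hf (ε / 2) (half_pos hε)
  filter_upwards [Metric.tendsto_nhds.1 hg (ε / 2) (half_pos hε)] with i hi
  rw [dist_zero_right, norm_norm] at hi ⊢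
  rw [dist_eq_norm] at hfg
  have h1 : ‖f i - g i‖ ≤ ‖f - g‖ := lp.norm_apply_le_norm ENNReal.top_ne_zero (f - g) i
  have h2 : ‖f i‖ ≤ ‖f i - g i‖ + ‖g i‖ := by simpa using norm_add_le (f i - g i) (g i)
  linarith

/-- The C⋆-algebraic direct sum `⨁ᵢ Aᵢ` (the `c₀`-sum). -/
def CStarSum : Type (max u v) := vanishingFamilies A

instance : NonUnitalCStarAlgebra (CStarSum A) :=
  inferInstanceAs (NonUnitalCStarAlgebra (vanishingFamilies A))

open scoped Classical in
/-- The element `a` of the `i`-th summand, as an element of `⨁ᵢ Aᵢ`. -/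
def CStarSum.single (i : I) (a : A i) : CStarSum A :=
  (⟨lp.single ∞ i a, by
    refine tendsto_const_nhds.congr' ?_
    rw [EventuallyEq, eventually_cofinite]
    refine (Set.finite_singleton i).subset fun j hj => ?_
    by_contra hne
    exact hj (by rw [lp.single_apply_ne _ _ _ hne, norm_zero])⟩ : vanishingFamilies A)

/-- A (separable) C⋆-algebra is AF if it is the closure of the union of an increasing sequence of
finite-dimensional ⋆-subalgebras. -/
def IsAF (D : Type w) [NonUnitalCStarAlgebra D] : Prop :=
  ∃ F : ℕ → NonUnitalStarSubalgebra ℂ D, Monotone F ∧ (∀ j, FiniteDimensional ℂ (F j)) ∧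
    Dense (⋃ j, (F j : Set D))

end targets

end

noncomputable section

/-! ### Isometric pairs of ⋆-homomorphisms -/

section isometricPairs

variable {A : Type v} {B : Type w} [NonUnitalCStarAlgebra A] [NonUnitalCStarAlgebra B]

/-! Fix a degree n. The elements s_μ s_ν* with μ, ν ∈ Λⁿ multiply like matrix units, with one block
for each common source (`CKFamily.isMatrixUnits_unit`). A ⋆-homomorphism that kills no diagonal
matrix unit is isometric on their span (`IsMatrixUnits.norm_map_eq`). Hence two systems of matrix
units with the same index set and nonzero diagonals can be compared inside the product of their
algebras: both coordinate projections are isometric on the span of the pairs, so the two closed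
spans are isomorphic. Comparing a level with the matrix units of ⨁ 𝒦 gives its structure.

Inserting s_v = ∑ s_α s_α* writes s_μ s_ν* as a sum of multiples of s_{μα} s_{να}*, so the levels
increase. Row-finiteness keeps these sums finite, which gives the AF property. The levels are dense
in the fixed-point algebra because averaging over well-chosen gauge automorphisms removes the
monomials of unequal degree from an approximant without increasing its distance to a fixed point
(`exists_norm_sub_le_of_fixed`). If every t_v is nonzero, π_t is isometric on each level, hence on
the whole fixed-point algebra.

The analytic input is s_v ≠ 0 (`univ_vertex_ne_zero`). For it, Λ acts on the ℓ²-space of the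
infinite paths that end in a fixed tail with range v. Along the tail the cocycle can be trivialised,
which supplies the phases that this action needs.

For independence of c, the inclusions of the levels (j, …, j) for c₁ and c₂ differ only by phases. A
recursion on j rescales the second matrix units so that both systems have the same inclusions. The
spans of pairs in the product then increase with j, and the comparison above applies to their union.
-/

theorem NonUnitalStarAlgHom.continuous_of_cstar (φ : A →⋆ₙₐ[ℂ] B) : Continuous φ :=
  AddMonoidHomClass.continuous_of_bound φ 1
    (by simpa only [one_mul] using! NonUnitalStarAlgHom.norm_apply_le φ)

theorem NonUnitalStarAlgHom.norm_map_of_mem_closure (φ : A →⋆ₙₐ[ℂ] B) {S : Set A}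
    (h : ∀ x ∈ S, ‖φ x‖ = ‖x‖) {x : A} (hx : x ∈ closure S) : ‖φ x‖ = ‖x‖ := by
  have : closure S ⊆ {x | ‖φ x‖ = ‖x‖} :=
    closure_minimal h (isClosed_eq φ.continuous_of_cstar.norm continuous_norm)
  exact this hx

/-- A ⋆-homomorphism that is isometric on a closed ⋆-subalgebra restricts to an isomorphism onto
the closure of the image of any dense part. -/
theorem NonUnitalStarSubalgebra.exists_starAlgEquiv_closure_image (D : NonUnitalStarSubalgebra ℂ A)
    {S : Set A} (hD : (D : Set A) = closure S) (φ : A →⋆ₙₐ[ℂ] B) (h : ∀ x ∈ S, ‖φ x‖ = ‖x‖)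
    (P : NonUnitalStarSubalgebra ℂ B) (hP : (P : Set B) = closure (φ '' S)) :
    ∃ e : D ≃⋆ₐ[ℂ] P, ∀ x : D, (e x : B) = φ x := by
  have hn : ∀ x ∈ D, ‖φ x‖ = ‖x‖ := fun x hx =>
    φ.norm_map_of_mem_closure h (by rw [← hD]; exact hx)
  have hiso : Isometry (fun x : D => φ x) := by
    refine Isometry.of_dist_eq fun x y => ?_
    rw [dist_eq_norm, ← map_sub, hn _ (sub_mem x.2 y.2), ← dist_eq_norm]
    rfl
  have hmem : ∀ x ∈ D, φ x ∈ P := fun x hx => by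
    change φ x ∈ (P : Set B)
    rw [hP]
    refine image_closure_subset_closure_image φ.continuous_of_cstar ⟨x, ?_, rfl⟩
    rw [← hD]
    exact hx
  let f : D →⋆ₙₐ[ℂ] P := NonUnitalStarAlgHom.codRestrict
    (φ.comp (NonUnitalStarSubalgebraClass.subtype D)) P fun x => hmem x x.2
  have hcl : IsClosed (D : Set A) := hD ▸ isClosed_closure
  have : CompleteSpace D := hcl.completeSpace_coe
  have hbij : Function.Bijective f := by
    refine ⟨fun x y hxy => hiso.injective (congrArg Subtype.val hxy), fun y => ?_⟩
    have hcr : IsClosed (Set.range (fun x : D => φ x)) := hiso.isClosedEmbedding.isClosed_range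
    -- The range is closed, being the isometric image of a complete space, so it contains the
    -- closure of φ(S).
    have hsub : closure (φ '' S) ⊆ Set.range (fun x : D => φ x) := by
      refine closure_minimal ?_ hcr
      rintro _ ⟨x, hx, rfl⟩
      refine ⟨⟨x, ?_⟩, rfl⟩
      change x ∈ (D : Set A)
      rw [hD]
      exact subset_closure hx
    have hy : (y : B) ∈ closure (φ '' S) := by rw [← hP]; exact y.2
    obtain ⟨x, hx⟩ := hsub hy
    exact ⟨x, Subtype.ext hx⟩
  exact ⟨StarAlgEquiv.ofBijective f hbij, fun x => rfl⟩

/-- Two closed ⋆-subalgebras are isomorphic as soon as they are the closures of the two images of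
a ⋆-subalgebra of the product on which the two coordinates have the same norm. -/
theorem NonUnitalStarSubalgebra.exists_starAlgEquiv_of_norm_eq
    (W : NonUnitalStarSubalgebra ℂ (A × B)) (h : ∀ w ∈ W, ‖w.1‖ = ‖w.2‖)
    (P : NonUnitalStarSubalgebra ℂ A) (Q : NonUnitalStarSubalgebra ℂ B)
    (hP : (P : Set A) = closure (Prod.fst '' (W : Set (A × B))))
    (hQ : (Q : Set B) = closure (Prod.snd '' (W : Set (A × B)))) :
    ∃ e : P ≃⋆ₐ[ℂ] Q, ∀ (w : A × B) (_ : w ∈ W) (h1 : w.1 ∈ P), (e ⟨w.1, h1⟩ : B) = w.2 := by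
  have hD : (W.topologicalClosure : Set (A × B)) = closure W := rfl
  have h1 : ∀ w ∈ (W : Set (A × B)), ‖NonUnitalStarAlgHom.fst ℂ A B w‖ = ‖w‖ := fun w hw => by
    change ‖w.1‖ = max ‖w.1‖ ‖w.2‖
    rw [← h w hw, max_self]
  have h2 : ∀ w ∈ (W : Set (A × B)), ‖NonUnitalStarAlgHom.snd ℂ A B w‖ = ‖w‖ := fun w hw => by
    change ‖w.2‖ = max ‖w.1‖ ‖w.2‖
    rw [h w hw, max_self]
  -- The norm of the product is the maximum of the two coordinate norms, so both projections are
  -- isometric on W. The isomorphism goes from P up to the closure of W and down to Q, which avoids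
  -- checking that a map prescribed on generators is well defined.
  obtain ⟨e₁, he₁⟩ := W.topologicalClosure.exists_starAlgEquiv_closure_image hD _ h1 P hP
  obtain ⟨e₂, he₂⟩ := W.topologicalClosure.exists_starAlgEquiv_closure_image hD _ h2 Q hQ
  refine ⟨e₁.symm.trans e₂, fun w hw hw1 => ?_⟩
  have hw' : w ∈ W.topologicalClosure := W.le_topologicalClosure hw
  have : e₁.symm ⟨w.1, hw1⟩ = ⟨w, hw'⟩ := by
    rw [StarAlgEquiv.symm_apply_eq]
    exact Subtype.ext (he₁ ⟨w, hw'⟩).symm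
  rw [StarAlgEquiv.trans_apply, this, he₂]
  rfl

end isometricPairs

/-! ### Matrix units -/

/-- A system of matrix units `θ x y` for the pairs `x`, `y` of the same colour. The elements
`θ x y` for pairs of different colours are zero. -/
structure IsMatrixUnits {E I : Type*} {A : Type*} [NonUnitalCStarAlgebra A]
    (col : E → I) (θ : E → E → A) : Prop where
  star_eq : ∀ x y, star (θ x y) = θ y x
  eq_zero : ∀ x y, col x ≠ col y → θ x y = 0
  mul_eq : ∀ x y z, col x = col y → θ x y * θ y z = θ x z
  mul_eq_zero : ∀ x y z t, y ≠ z → θ x y * θ z t = 0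

namespace IsMatrixUnits

variable {E I : Type*} {A : Type v} {B : Type w} [NonUnitalCStarAlgebra A]
  [NonUnitalCStarAlgebra B] {col : E → I} {θ : E → E → A}

theorem map (h : IsMatrixUnits col θ) (φ : A →⋆ₙₐ[ℂ] B) :
    IsMatrixUnits col fun x y => φ (θ x y) where
  star_eq x y := by rw [← map_star, h.star_eq]
  eq_zero x y hxy := by rw [h.eq_zero x y hxy, map_zero]
  mul_eq x y z hxy := by rw [← map_mul, h.mul_eq x y z hxy]
  mul_eq_zero x y z t hyz := by rw [← map_mul, h.mul_eq_zero x y z t hyz, map_zero]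

theorem prodMk (h : IsMatrixUnits col θ) {η : E → E → B} (h' : IsMatrixUnits col η) :
    IsMatrixUnits col fun x y => (θ x y, η x y) where
  star_eq x y := Prod.ext (h.star_eq x y) (h'.star_eq x y)
  eq_zero x y hxy := Prod.ext (h.eq_zero x y hxy) (h'.eq_zero x y hxy)
  mul_eq x y z hxy := Prod.ext (h.mul_eq x y z hxy) (h'.mul_eq x y z hxy)
  mul_eq_zero x y z t hyz := Prod.ext (h.mul_eq_zero x y z t hyz) (h'.mul_eq_zero x y z t hyz)

/-- Matrix units remain matrix units when they are multiplied by the phases `u x * conj (u y)`. -/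
theorem phase (h : IsMatrixUnits col θ) (p : E → Circle) :
    IsMatrixUnits col fun x y => ((p x * (p y)⁻¹ : Circle) : ℂ) • θ x y where
  star_eq x y := by
    rw [star_smul, h.star_eq, RCLike.star_def, ← Circle.coe_inv_eq_conj]
    congr 2
    rw [mul_inv, inv_inv, mul_comm]
  eq_zero x y hxy := by rw [h.eq_zero x y hxy, smul_zero]
  mul_eq x y z hxy := by
    rw [smul_mul_smul_comm, h.mul_eq x y z hxy, ← Circle.coe_mul]
    congr 2
    rw [mul_assoc, inv_mul_cancel_left]
  mul_eq_zero x y z t hyz := by rw [smul_mul_smul_comm, h.mul_eq_zero x y z t hyz, smul_zero]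

/-- The ⋆-subalgebra spanned by the matrix units with indices in `F`. -/
def subalgebra (h : IsMatrixUnits col θ) (F : Set E) : NonUnitalStarSubalgebra ℂ A where
  toSubmodule := Submodule.span ℂ (Set.image2 θ F F)
  mul_mem' {a b} ha hb := by
    change a ∈ Submodule.span ℂ (Set.image2 θ F F) at ha
    change b ∈ Submodule.span ℂ (Set.image2 θ F F) at hb
    change a * b ∈ Submodule.span ℂ (Set.image2 θ F F)
    induction ha, hb using Submodule.span_induction₂ with
    | mem_mem a b ha hb =>
      obtain ⟨x, hx, y, hy, rfl⟩ := ha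
      obtain ⟨z, hz, t, ht, rfl⟩ := hb
      by_cases hyz : y = z
      · subst hyz
        by_cases hxy : col x = col y
        · rw [h.mul_eq x y t hxy]
          exact Submodule.subset_span ⟨x, hx, t, ht, rfl⟩
        · rw [h.eq_zero x y hxy, zero_mul]
          exact zero_mem _
      · rw [h.mul_eq_zero x y z t hyz]
        exact zero_mem _
    | zero_left b hb => simp
    | zero_right a ha => simp
    | add_left a a' b _ _ _ h1 h2 => rw [add_mul]; exact add_mem h1 h2
    | add_right a b b' _ _ _ h1 h2 => rw [mul_add]; exact add_mem h1 h2
    | smul_left r a b _ _ h1 => rw [smul_mul_assoc]; exact Submodule.smul_mem _ _ h1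
    | smul_right r a b _ _ h1 => rw [mul_smul_comm]; exact Submodule.smul_mem _ _ h1
  star_mem' {a} ha := by
    change a ∈ Submodule.span ℂ (Set.image2 θ F F) at ha
    change star a ∈ Submodule.span ℂ (Set.image2 θ F F)
    induction ha using Submodule.span_induction with
    | mem a ha =>
      obtain ⟨x, hx, y, hy, rfl⟩ := ha
      rw [h.star_eq]
      exact Submodule.subset_span ⟨y, hy, x, hx, rfl⟩
    | zero => simp
    | add a b _ _ ha hb => rw [star_add]; exact add_mem ha hb
    | smul r a _ ha => rw [star_smul]; exact Submodule.smul_mem _ _ ha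

theorem mem_subalgebra (h : IsMatrixUnits col θ) {F : Set E} {a : A} :
    a ∈ h.subalgebra F ↔ a ∈ Submodule.span ℂ (Set.image2 θ F F) := Iff.rfl

theorem unit_mem_subalgebra (h : IsMatrixUnits col θ) {F : Set E} {x y : E} (hx : x ∈ F)
    (hy : y ∈ F) : θ x y ∈ h.subalgebra F :=
  Submodule.subset_span ⟨x, hx, y, hy, rfl⟩

theorem subalgebra_le (h : IsMatrixUnits col θ) {F : Set E} {S : NonUnitalStarSubalgebra ℂ A}
    (hS : ∀ x ∈ F, ∀ y ∈ F, θ x y ∈ S) : h.subalgebra F ≤ S := by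
  intro a ha
  refine (Submodule.span_le (p := S.toSubmodule)).2 ?_ ha
  rintro _ ⟨x, hx, y, hy, rfl⟩
  exact hS x hx y hy

theorem subalgebra_mono (h : IsMatrixUnits col θ) {F G : Set E} (hFG : F ⊆ G) :
    h.subalgebra F ≤ h.subalgebra G :=
  h.subalgebra_le fun _ hx _ hy => h.unit_mem_subalgebra (hFG hx) (hFG hy)

theorem finiteDimensional_subalgebra (h : IsMatrixUnits col θ) {F : Set E} (hF : F.Finite) :
    FiniteDimensional ℂ (h.subalgebra F) :=
  FiniteDimensional.span_of_finite ℂ (hF.image2 θ hF)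

theorem exists_finset_of_mem (h : IsMatrixUnits col θ) {F : Set E} {a : A}
    (ha : a ∈ h.subalgebra F) : ∃ G : Finset E, a ∈ h.subalgebra (G : Set E) := by
  classical
  rw [mem_subalgebra] at ha
  induction ha using Submodule.span_induction with
  | mem a ha =>
    obtain ⟨x, hx, y, hy, rfl⟩ := ha
    exact ⟨{x, y}, h.unit_mem_subalgebra (by simp) (by simp)⟩
  | zero => exact ⟨∅, zero_mem _⟩
  | add a b _ _ ha hb =>
    obtain ⟨G, hG⟩ := ha
    obtain ⟨G', hG'⟩ := hb
    exact ⟨G ∪ G', add_mem (h.subalgebra_mono (by simp) hG) (h.subalgebra_mono (by simp) hG')⟩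
  | smul r a _ ha =>
    obtain ⟨G, hG⟩ := ha
    exact ⟨G, SMulMemClass.smul_mem r hG⟩

theorem corner (h : IsMatrixUnits col θ) (x y a b : E) [Decidable (a = x)] [Decidable (b = y)] :
    θ x x * θ a b * θ y y = if a = x then if b = y then θ x y else 0 else 0 := by
  split_ifs with hx hy
  · subst hx hy
    rw [h.mul_eq a a b rfl]
    by_cases hab : col a = col b
    · exact h.mul_eq a b b hab
    · rw [h.eq_zero a b hab, zero_mul]
  · subst hx
    rw [h.mul_eq a a b rfl, h.mul_eq_zero _ _ _ _ hy]
  · rw [h.mul_eq_zero _ _ _ _ (Ne.symm hx), zero_mul]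

/-- The scalar r is the matrix coefficient of a at (x, y). It is not unique when θ x y = 0. -/
theorem exists_corner_eq_smul (h : IsMatrixUnits col θ) {F : Set E} {a : A}
    (ha : a ∈ h.subalgebra F) (x y : E) : ∃ r : ℂ, θ x x * a * θ y y = r • θ x y := by
  classical
  rw [mem_subalgebra] at ha
  induction ha using Submodule.span_induction with
  | mem a ha =>
    obtain ⟨a, -, b, -, rfl⟩ := ha
    rw [h.corner]
    split_ifs
    · exact ⟨1, (one_smul _ _).symm⟩
    · exact ⟨0, (zero_smul _ _).symm⟩
    · exact ⟨0, (zero_smul _ _).symm⟩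
  | zero => exact ⟨0, by simp⟩
  | add a b _ _ ha hb =>
    obtain ⟨r, hr⟩ := ha
    obtain ⟨s, hs⟩ := hb
    exact ⟨r + s, by rw [mul_add, add_mul, hr, hs, add_smul]⟩
  | smul t a _ ha =>
    obtain ⟨r, hr⟩ := ha
    exact ⟨t * r, by rw [mul_smul_comm, smul_mul_assoc, hr, smul_smul]⟩

theorem sum_corner (h : IsMatrixUnits col θ) (F : Finset E) {a : A}
    (ha : a ∈ h.subalgebra (F : Set E)) : ∑ x ∈ F, ∑ y ∈ F, θ x x * a * θ y y = a := by
  classical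
  rw [mem_subalgebra] at ha
  induction ha using Submodule.span_induction with
  | mem a ha =>
    obtain ⟨a, ha, b, hb, rfl⟩ := ha
    simp only [h.corner, Finset.sum_ite_eq, Finset.sum_ite_irrel]
    simp_all
  | zero => simp
  | add a b _ _ ha hb =>
    simp only [mul_add, add_mul, Finset.sum_add_distrib, ha, hb]
  | smul t a _ ha =>
    simp only [mul_smul_comm, smul_mul_assoc, ← Finset.smul_sum, ha]

/-- By `sum_corner`, a is the sum of its corners r θ x y. Each corner is killed by φ, so either r =
0 or φ(θ x y) = 0. For x, y of the same colour the second case would give φ(θ x x) = φ(θ x y) φ(θ y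
x) = 0. -/
theorem eq_zero_of_map_eq_zero (h : IsMatrixUnits col θ) (φ : A →⋆ₙₐ[ℂ] B)
    (hφ : ∀ x, φ (θ x x) ≠ 0) (F : Finset E) {a : A} (ha : a ∈ h.subalgebra (F : Set E))
    (h0 : φ a = 0) : a = 0 := by
  rw [← h.sum_corner F ha]
  refine Finset.sum_eq_zero fun x _ => Finset.sum_eq_zero fun y _ => ?_
  obtain ⟨r, hr⟩ := h.exists_corner_eq_smul ha x y
  have h1 : r • φ (θ x y) = 0 := by
    rw [← map_smul, ← hr, map_mul, map_mul, h0, mul_zero, zero_mul]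
  rw [hr]
  rcases smul_eq_zero.1 h1 with h2 | h2
  · rw [h2, zero_smul]
  · by_cases hxy : col x = col y
    · refine absurd ?_ (hφ x)
      rw [← h.mul_eq x y x hxy, map_mul, h2, zero_mul]
    · rw [h.eq_zero x y hxy, smul_zero]

/-- A ⋆-homomorphism that kills no diagonal matrix unit is isometric on the span of the matrix
units. -/
theorem norm_map_eq (h : IsMatrixUnits col θ) (φ : A →⋆ₙₐ[ℂ] B) (hφ : ∀ x, φ (θ x x) ≠ 0)
    {F : Set E} {a : A} (ha : a ∈ h.subalgebra F) : ‖φ a‖ = ‖a‖ := by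
  obtain ⟨G, hG⟩ := h.exists_finset_of_mem ha
  -- Finitely many indices span a finite-dimensional, hence closed, ⋆-subalgebra. It is a
  -- C⋆-algebra, and injective ⋆-homomorphisms of C⋆-algebras are isometric.
  have := h.finiteDimensional_subalgebra G.finite_toSet
  have : IsClosed (h.subalgebra (G : Set E) : Set A) :=
    Submodule.closed_of_finiteDimensional (h.subalgebra (G : Set E)).toSubmodule
  have hinj : Function.Injective
      (φ.comp (NonUnitalStarSubalgebraClass.subtype (h.subalgebra (G : Set E)))) := by
    refine (injective_iff_map_eq_zero _).2 fun x hx => Subtype.ext ?_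
    exact h.eq_zero_of_map_eq_zero φ hφ G x.2 hx
  exact NonUnitalStarAlgHom.norm_map _ hinj ⟨a, hG⟩

end IsMatrixUnits

/-! ### Relations in Cuntz–Krieger families -/

/-- Projections whose sum dominates each of them as a unit are mutually orthogonal. -/
theorem IsStarProjection.mul_eq_zero_of_sum {B : Type w} [NonUnitalCStarAlgebra B] {ι : Type*}
    [Fintype ι] {p : ι → B} (hp : ∀ i, IsStarProjection (p i)) (hs : ∀ i, (∑ j, p j) * p i = p i)
    {i j : ι} (hij : i ≠ j) : p i * p j = 0 := by
  classical
  let _ := CStarAlgebra.spectralOrder B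
  let _ := CStarAlgebra.spectralOrderedRing B
  have hsq : ∀ i j, p i * p j * p i = star (p j * p i) * (p j * p i) := fun i j => by
    rw [star_mul, (hp i).isSelfAdjoint.star_eq, (hp j).isSelfAdjoint.star_eq]
    nth_rw 1 [← (hp j).isIdempotentElem.eq]
    simp only [mul_assoc]
  -- Compressing the sum by p j gives p j, which is already the term l = j. The other terms are
  -- positive with sum zero, so each of them vanishes.
  have h1 : ∑ l ∈ Finset.univ.erase j, p j * p l * p j = 0 := by
    have h2 : ∑ l, p j * p l * p j = p j := by
      rw [← Finset.sum_mul, ← Finset.mul_sum, mul_assoc, hs, (hp j).isIdempotentElem.eq]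
    rw [← Finset.add_sum_erase _ _ (Finset.mem_univ j)] at h2
    rw [(hp j).isIdempotentElem.eq, (hp j).isIdempotentElem.eq] at h2
    exact add_eq_left.1 h2
  have h3 := (Finset.sum_eq_zero_iff_of_nonneg fun l _ => by
    rw [hsq]; exact star_mul_self_nonneg _).1 h1 i (Finset.mem_erase.2 ⟨hij, Finset.mem_univ i⟩)
  rw [hsq] at h3
  exact CStarRing.star_mul_self_eq_zero_iff _ |>.1 h3

namespace KGraph

variable {k : ℕ} {Λ : KGraph.{u} k}

/-- The path `pα`, for `p ∈ Λᵐ` and `α ∈ s(p) Λʳ`, as an element of `Λⁿ`, where `m + r = n`. -/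
def Path.extend {m r n : Fin k → ℕ} (h : m + r = n) (p : Λ.Path m) (α : Λ.PathTo p.1 r) :
    Λ.Path n :=
  ⟨α.1, p.2.1, α.2.1 ≫ p.2.2.1, by rw [Λ.deg_mul, p.2.2.2, α.2.2, h]⟩

theorem Path.extend_surjective {m r n : Fin k → ℕ} (h : m + r = n) (q : Λ.Path n) :
    ∃ (p : Λ.Path m) (α : Λ.PathTo p.1 r), p.extend h α = q := by
  obtain ⟨a, b, l, hl⟩ := q
  obtain ⟨⟨e, μ, ν⟩, ⟨h1, h2, h3⟩, -⟩ := Λ.factorisation l m r (hl.trans h.symm)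
  refine ⟨⟨e, b, μ, h1⟩, ⟨a, ν, h2⟩, ?_⟩
  change (⟨a, b, ν ≫ μ, _⟩ : Λ.Path n) = _
  congr

/-- This is the uniqueness half of the factorisation property. The sigma type makes the equality of
the intermediate vertices part of the conclusion. -/
theorem Path.extend_injective {m r n : Fin k → ℕ} (h : m + r = n) :
    Function.Injective fun x : Σ p : Λ.Path m, Λ.PathTo p.1 r => x.1.extend h x.2 := by
  rintro ⟨⟨e, b, μ, hμ⟩, ⟨a, α, hα⟩⟩ ⟨⟨e', b', μ', hμ'⟩, ⟨a', α', hα'⟩⟩ hx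
  change (⟨a, b, α ≫ μ, _⟩ : Λ.Path n) = ⟨a', b', α' ≫ μ', _⟩ at hx
  obtain ⟨rfl, hx⟩ := Sigma.mk.inj_iff.1 hx
  obtain ⟨rfl, hx⟩ := Sigma.mk.inj_iff.1 (eq_of_heq hx)
  have hx := congrArg Subtype.val (eq_of_heq hx)
  change α ≫ μ = α' ≫ μ' at hx
  have := (Λ.factorisation (α ≫ μ) m r (by rw [Λ.deg_mul, hμ, hα])).unique
    (y₁ := ⟨e, μ, α⟩) (y₂ := ⟨e', μ', α'⟩) ⟨hμ, hα, rfl⟩ ⟨hμ', hα', hx.symm⟩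
  obtain ⟨rfl, this⟩ := Sigma.mk.inj_iff.1 this
  obtain ⟨rfl, rfl⟩ := Prod.mk_inj.1 (eq_of_heq this)
  rfl

instance (n : Fin k → ℕ) : Countable (Λ.Path n) :=
  inferInstanceAs (Countable (Σ (a b : Λ.Obj), {l : a ⟶ b // Λ.deg l = n}))

variable [Λ.RowFinite] {c : Λ.TwoCocycle}

namespace CKFamily

variable {B : Type w} [NonUnitalCStarAlgebra B] (t : CKFamily c B)

theorem range_mul ⦃a b : Λ.Obj⦄ (l : a ⟶ b) : t (𝟙 b) * t l = t l := by
  rw [t.ck2, c.id_left, Category.comp_id, Circle.coe_one, one_smul]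

theorem mul_source ⦃a b : Λ.Obj⦄ (l : a ⟶ b) : t l * t (𝟙 a) = t l := by
  rw [t.ck2, c.id_right, Category.id_comp, Circle.coe_one, one_smul]

theorem star_vertex (v : Λ.Obj) : star (t (𝟙 v)) = t (𝟙 v) :=
  (t.ck1_proj v).isSelfAdjoint.star_eq

theorem source_mul_star ⦃a b : Λ.Obj⦄ (l : a ⟶ b) : t (𝟙 a) * star (t l) = star (t l) := by
  rw [← t.star_vertex, ← star_mul, t.mul_source]

theorem star_mul_range ⦃a b : Λ.Obj⦄ (l : a ⟶ b) : star (t l) * t (𝟙 b) = star (t l) := by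
  rw [← t.star_vertex, ← star_mul, t.range_mul]

theorem isStarProjection_mul_star ⦃a b : Λ.Obj⦄ (l : a ⟶ b) :
    IsStarProjection (t l * star (t l)) := by
  refine ⟨?_, ?_⟩
  · rw [IsIdempotentElem, mul_assoc, ← mul_assoc (star (t l)), t.ck3, t.source_mul_star]
  · rw [isSelfAdjoint_iff, star_mul, star_star]

theorem mul_star_eq_zero ⦃a b a' b' : Λ.Obj⦄ (μ : a ⟶ b) (ν : a' ⟶ b') (h : a ≠ a') :
    t μ * star (t ν) = 0 := by
  rw [← t.mul_source μ, ← t.source_mul_star ν, mul_assoc, ← mul_assoc (t (𝟙 a)), t.ck1_orth a a' h,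
    zero_mul, mul_zero]

/-- For a common range b, CK4 says that the range projections of the paths in bΛⁿ add up to t_b,
which acts on each as a unit, so they are mutually orthogonal. For different ranges the vertex
projections are orthogonal. -/
theorem star_mul_eq_zero {n : Fin k → ℕ} {p q : Λ.Path n} (h : p ≠ q) :
    star (t p.2.2.1) * t q.2.2.1 = 0 := by
  obtain ⟨a, b, μ, hμ⟩ := p
  obtain ⟨a', b', ν, hν⟩ := q
  change star (t μ) * t ν = 0
  by_cases hb : b = b'
  · subst hb
    have key := IsStarProjection.mul_eq_zero_of_sum
      (p := fun p : Λ.PathTo b n => t p.2.1 * star (t p.2.1))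
      (fun p => t.isStarProjection_mul_star p.2.1)
      (fun p => by rw [← t.ck4, ← mul_assoc, t.range_mul])
      (i := ⟨a, μ, hμ⟩) (j := ⟨a', ν, hν⟩) (by
        intro h'
        apply h
        obtain ⟨rfl, h'⟩ := Sigma.mk.inj_iff.1 h'
        obtain rfl := congrArg Subtype.val (eq_of_heq h')
        rfl)
    calc star (t μ) * t ν
        = star (t μ) * t μ * star (t μ) * (t ν * (star (t ν) * t ν)) := by
          rw [t.ck3, t.ck3, t.source_mul_star, t.mul_source]
      _ = star (t μ) * ((t μ * star (t μ)) * (t ν * star (t ν))) * t ν := by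
          simp only [mul_assoc]
      _ = 0 := by
          have key' : (t μ * star (t μ)) * (t ν * star (t ν)) = 0 := key
          rw [key', mul_zero, zero_mul]
  · rw [← t.range_mul ν, ← t.star_mul_range μ, mul_assoc, ← mul_assoc (t (𝟙 b)),
      t.ck1_orth b b' hb, zero_mul, mul_zero]

/-- The elements `t_μ t_ν*` with `μ, ν ∈ Λⁿ`. -/
def unit (n : Fin k → ℕ) (p q : Λ.Path n) : B := t p.2.2.1 * star (t q.2.2.1)

theorem isMatrixUnits_unit (n : Fin k → ℕ) :
    IsMatrixUnits (fun p : Λ.Path n => p.1) (t.unit n) where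
  star_eq p q := by rw [unit, star_mul, star_star, unit]
  eq_zero p q h := t.mul_star_eq_zero _ _ h
  mul_eq := by
    rintro ⟨a, b, μ, hμ⟩ ⟨a', b', ν, hν⟩ r h
    obtain rfl : a = a' := h
    change t μ * star (t ν) * (t ν * star (t r.2.2.1)) = t μ * star (t r.2.2.1)
    rw [mul_assoc, ← mul_assoc (star (t ν)), t.ck3, ← mul_assoc, t.mul_source]
  mul_eq_zero p q r s h := by
    rw [unit, unit, mul_assoc, ← mul_assoc (star _), t.star_mul_eq_zero h, zero_mul, mul_zero]

theorem unit_self_ne_zero (ht : ∀ v : Λ.Obj, t (𝟙 v) ≠ 0) (n : Fin k → ℕ) (p : Λ.Path n) :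
    t.unit n p p ≠ 0 := by
  intro h
  apply ht p.1
  calc t (𝟙 p.1) = (star (t p.2.2.1) * t p.2.2.1) * (star (t p.2.2.1) * t p.2.2.1) := by
        rw [t.ck3, (t.ck1_proj _).isIdempotentElem.eq]
    _ = star (t p.2.2.1) * t.unit n p p * t p.2.2.1 := by simp only [unit, mul_assoc]
    _ = 0 := by rw [h, mul_zero, zero_mul]

/-- CK4 at the common source a is inserted between the two factors, and CK2 is applied on both
sides. The resulting phases are the only trace of the cocycle in the inclusions of the levels. -/
theorem mul_star_eq_sum ⦃a b b' : Λ.Obj⦄ (μ : a ⟶ b) (ν : a ⟶ b') (n : Fin k → ℕ) :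
    t μ * star (t ν) = ∑ α : Λ.PathTo a n, ((c μ α.2.1 * (c ν α.2.1)⁻¹ : Circle) : ℂ) •
      (t (α.2.1 ≫ μ) * star (t (α.2.1 ≫ ν))) := by
  conv_lhs => rw [← t.mul_source μ, t.ck4 a n, Finset.mul_sum, Finset.sum_mul]
  refine Finset.sum_congr rfl fun α _ => ?_
  rw [← mul_assoc, mul_assoc, ← star_mul, t.ck2, t.ck2, star_smul, smul_mul_smul_comm,
    Circle.coe_mul, Circle.coe_inv_eq_conj]
  rfl

/-- The sources of p and q are only propositionally equal, hence the transport of α along `hpq`. -/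
theorem unit_eq_sum {m r n : Fin k → ℕ} (h : m + r = n) (p q : Λ.Path m) (hpq : p.1 = q.1) :
    t.unit m p q = ∑ α : Λ.PathTo p.1 r,
      ((c p.2.2.1 α.2.1 * (c q.2.2.1 (hpq ▸ α : Λ.PathTo q.1 r).2.1)⁻¹ : Circle) : ℂ) •
        t.unit n (p.extend h α) (q.extend h (hpq ▸ α)) := by
  obtain ⟨a, b, μ, hμ⟩ := p
  obtain ⟨a', b', ν, hν⟩ := q
  obtain rfl : a = a' := hpq
  exact t.mul_star_eq_sum μ ν r

/-- The span of `t_μ t_ν*` for `μ, ν ∈ Λⁿ`. -/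
def level (n : Fin k → ℕ) : NonUnitalStarSubalgebra ℂ B :=
  (t.isMatrixUnits_unit n).subalgebra Set.univ

theorem unit_mem_level (n : Fin k → ℕ) (p q : Λ.Path n) : t.unit n p q ∈ t.level n :=
  (t.isMatrixUnits_unit n).unit_mem_subalgebra (Set.mem_univ p) (Set.mem_univ q)

theorem subalgebra_le_subalgebra_extend {m r n : Fin k → ℕ} (h : m + r = n) (F : Set (Λ.Path m)) :
    (t.isMatrixUnits_unit m).subalgebra F ≤ (t.isMatrixUnits_unit n).subalgebra
      (⋃ p ∈ F, Set.range fun α => p.extend h α) := by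
  refine (t.isMatrixUnits_unit m).subalgebra_le fun p hp q hq => ?_
  by_cases hpq : p.1 = q.1
  · rw [t.unit_eq_sum h p q hpq]
    refine sum_mem fun α _ => SMulMemClass.smul_mem _ ?_
    exact (t.isMatrixUnits_unit n).unit_mem_subalgebra
      (Set.mem_biUnion hp ⟨α, rfl⟩) (Set.mem_biUnion hq ⟨_, rfl⟩)
  · rw [(t.isMatrixUnits_unit m).eq_zero p q hpq]
    exact zero_mem _

theorem level_mono {m n : Fin k → ℕ} (h : m ≤ n) : t.level m ≤ t.level n :=
  (t.subalgebra_le_subalgebra_extend (add_tsub_cancel_of_le h) Set.univ).trans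
    ((t.isMatrixUnits_unit n).subalgebra_mono (Set.subset_univ _))

/-- The set of the elements `t_μ t_ν*` with `s(μ) = s(ν)`. -/
def monomials : Set B :=
  {x | ∃ (a b b' : Λ.Obj) (μ : a ⟶ b) (ν : a ⟶ b'), x = t μ * star (t ν)}

theorem mul_mem_span_monomials {x y : B} (hx : x ∈ t.monomials) (hy : y ∈ t.monomials) :
    x * y ∈ Submodule.span ℂ t.monomials := by
  obtain ⟨a, b, b', μ, ν, rfl⟩ := hx
  obtain ⟨e, f, f', ρ, σ, rfl⟩ := hy
  -- Both monomials are expanded so that the inner paths αν and βρ get the same degree d(ν) + d(ρ).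
  -- The inner product is then a vertex projection or zero.
  rw [t.mul_star_eq_sum μ ν (Λ.deg ρ), t.mul_star_eq_sum ρ σ (Λ.deg ν), Finset.sum_mul]
  refine sum_mem fun α _ => ?_
  rw [Finset.mul_sum]
  refine sum_mem fun β _ => ?_
  rw [smul_mul_smul_comm]
  refine Submodule.smul_mem _ _ ?_
  let p : Λ.Path (Λ.deg ν + Λ.deg ρ) := ⟨_, _, α.2.1 ≫ ν, by rw [Λ.deg_mul, α.2.2]⟩
  let q : Λ.Path (Λ.deg ν + Λ.deg ρ) := ⟨_, _, β.2.1 ≫ ρ, by rw [Λ.deg_mul, β.2.2, add_comm]⟩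
  rw [mul_assoc, ← mul_assoc (star _)]
  by_cases hpq : p = q
  · have h1 : star (t (α.2.1 ≫ ν)) * t (β.2.1 ≫ ρ) = t (𝟙 β.1) := by
      change star (t p.2.2.1) * t q.2.2.1 = t (𝟙 q.1)
      rw [hpq, t.ck3]
    have h2 : α.1 = β.1 := congrArg Sigma.fst hpq
    rw [h1, t.source_mul_star]
    obtain ⟨a₁, α, hα⟩ := α
    obtain ⟨a₂, β, hβ⟩ := β
    obtain rfl : a₁ = a₂ := h2
    exact Submodule.subset_span ⟨_, _, _, α ≫ μ, β ≫ σ, rfl⟩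
  · have h1 : star (t (α.2.1 ≫ ν)) * t (β.2.1 ≫ ρ) = 0 := t.star_mul_eq_zero hpq
    rw [h1, zero_mul, mul_zero]
    exact zero_mem _

/-- The span of the elements `t_μ t_ν*`, as a ⋆-subalgebra. -/
def monomialSpan : NonUnitalStarSubalgebra ℂ B where
  toSubmodule := Submodule.span ℂ t.monomials
  mul_mem' {x y} hx hy := by
    change x ∈ Submodule.span ℂ t.monomials at hx
    change y ∈ Submodule.span ℂ t.monomials at hy
    change x * y ∈ Submodule.span ℂ t.monomials
    induction hx, hy using Submodule.span_induction₂ with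
    | mem_mem a b ha hb => exact t.mul_mem_span_monomials ha hb
    | zero_left b hb => simp
    | zero_right a ha => simp
    | add_left a a' b _ _ _ h1 h2 => rw [add_mul]; exact add_mem h1 h2
    | add_right a b b' _ _ _ h1 h2 => rw [mul_add]; exact add_mem h1 h2
    | smul_left r a b _ _ h1 => rw [smul_mul_assoc]; exact Submodule.smul_mem _ _ h1
    | smul_right r a b _ _ h1 => rw [mul_smul_comm]; exact Submodule.smul_mem _ _ h1
  star_mem' {x} hx := by
    change x ∈ Submodule.span ℂ t.monomials at hx
    change star x ∈ Submodule.span ℂ t.monomials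
    induction hx using Submodule.span_induction with
    | mem a ha =>
      obtain ⟨a, b, b', μ, ν, rfl⟩ := ha
      rw [star_mul, star_star]
      exact Submodule.subset_span ⟨a, b', b, ν, μ, rfl⟩
    | zero => simp
    | add a b _ _ ha hb => rw [star_add]; exact add_mem ha hb
    | smul r a _ ha => rw [star_smul]; exact Submodule.smul_mem _ _ ha

theorem mem_monomialSpan ⦃a b : Λ.Obj⦄ (l : a ⟶ b) : t l ∈ t.monomialSpan :=
  Submodule.subset_span ⟨a, b, a, l, 𝟙 a, by rw [t.star_vertex, t.mul_source]⟩

end CKFamily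

/-- The universal property lifts the generators into S. Composed with the inclusion of S, this lift
is the identity by uniqueness, so every x lies in S. -/
theorem CStar.mem_of_forall_univ_mem (S : NonUnitalStarSubalgebra ℂ (CStar c))
    [IsClosed (S : Set (CStar c))] (h : ∀ ⦃a b : Λ.Obj⦄ (l : a ⟶ b), univ c l ∈ S)
    (x : CStar c) : x ∈ S := by
  have key : (NonUnitalStarSubalgebraClass.subtype S).comp (lift ((univ c).codRestrict S h))
      = NonUnitalStarAlgHom.id ℂ (CStar c) := by
    refine CStar.hom_ext fun a b l => ?_
    rw [NonUnitalStarAlgHom.comp_apply, lift_univ]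
    rfl
  have := DFunLike.congr_fun key x
  rw [NonUnitalStarAlgHom.comp_apply] at this
  change _ = x at this
  rw [← this]
  exact (lift ((univ c).codRestrict S h) x).2

theorem CStar.mem_closure_monomialSpan (x : CStar c) :
    x ∈ closure ((univ c).monomialSpan : Set (CStar c)) := by
  have : IsClosed ((univ c).monomialSpan.topologicalClosure : Set (CStar c)) :=
    NonUnitalStarSubalgebra.isClosed_topologicalClosure _
  exact CStar.mem_of_forall_univ_mem (univ c).monomialSpan.topologicalClosure
    (fun a b l => NonUnitalStarSubalgebra.le_topologicalClosure _ ((univ c).mem_monomialSpan l)) x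

theorem coe_levelSpan (c : Λ.TwoCocycle) (n : Fin k → ℕ) :
    (levelSpan c n : Set (CStar c)) = ((univ c).level n : Set (CStar c)) := by
  refine congrArg (fun S : Set (CStar c) => (Submodule.span ℂ S : Set (CStar c))) ?_
  ext x
  constructor
  · rintro ⟨μ, ν, rfl⟩
    exact ⟨μ, Set.mem_univ _, ν, Set.mem_univ _, rfl⟩
  · rintro ⟨μ, -, ν, -, rfl⟩
    exact ⟨μ, ν, rfl⟩

end KGraph

/-! ### Partial isometries between orthonormal families -/

section partialIsometries

variable {J : Type*} {H : Type*} [NormedAddCommGroup H] [InnerProductSpace ℂ H] [CompleteSpace H]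

/-- The isometry of `ℓ²(J)` into `H` that maps the standard basis to an orthonormal family. -/
def Orthonormal.lpIsometry {a : J → H} (ha : Orthonormal ℂ a) : lp (fun _ : J => ℂ) 2 →ₗᵢ[ℂ] H :=
  ha.orthogonalFamily.linearIsometry

open scoped Classical in
theorem Orthonormal.lpIsometry_single {a : J → H} (ha : Orthonormal ℂ a) (j : J) :
    ha.lpIsometry (lp.single 2 j 1) = a j := by
  rw [lpIsometry, OrthogonalFamily.linearIsometry_apply_single]
  simp

/-- The partial isometry that maps the orthonormal family `b` to the orthonormal family `a`. -/
def Orthonormal.partialIsometry {a b : J → H} (ha : Orthonormal ℂ a) (hb : Orthonormal ℂ b) :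
    H →L[ℂ] H :=
  ha.lpIsometry.toContinuousLinearMap ∘L
    ContinuousLinearMap.adjoint hb.lpIsometry.toContinuousLinearMap

theorem Orthonormal.adjoint_lpIsometry_apply {a : J → H} (ha : Orthonormal ℂ a)
    (x : lp (fun _ : J => ℂ) 2) :
    ContinuousLinearMap.adjoint ha.lpIsometry.toContinuousLinearMap (ha.lpIsometry x) = x := by
  refine ext_inner_right ℂ fun y => ?_
  rw [ContinuousLinearMap.adjoint_inner_left]
  exact ha.lpIsometry.inner_map_map x y

theorem Orthonormal.partialIsometry_apply {a b : J → H} (ha : Orthonormal ℂ a)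
    (hb : Orthonormal ℂ b) (j : J) : ha.partialIsometry hb (b j) = a j := by
  classical
  rw [partialIsometry, ContinuousLinearMap.comp_apply]
  nth_rw 1 [← hb.lpIsometry_single j]
  rw [hb.adjoint_lpIsometry_apply]
  exact ha.lpIsometry_single j

theorem Orthonormal.partialIsometry_apply_eq_zero {a b : J → H} (ha : Orthonormal ℂ a)
    (hb : Orthonormal ℂ b) {x : H} (hx : ∀ j, inner ℂ (b j) x = 0) :
    ha.partialIsometry hb x = 0 := by
  classical
  have : ContinuousLinearMap.adjoint hb.lpIsometry.toContinuousLinearMap x = 0 := by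
    refine lp.ext (funext fun j => ?_)
    have h1 : inner ℂ (lp.single 2 j (1 : ℂ))
        (ContinuousLinearMap.adjoint hb.lpIsometry.toContinuousLinearMap x) = 0 := by
      rw [ContinuousLinearMap.adjoint_inner_right]
      exact (congrArg (fun y => inner ℂ y x) (hb.lpIsometry_single j)).trans (hx j)
    rw [lp.inner_single_left] at h1
    simpa using h1
  rw [partialIsometry, ContinuousLinearMap.comp_apply, this, map_zero]

theorem Orthonormal.star_partialIsometry {a b : J → H} (ha : Orthonormal ℂ a)
    (hb : Orthonormal ℂ b) : star (ha.partialIsometry hb) = hb.partialIsometry ha := by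
  rw [ContinuousLinearMap.star_eq_adjoint, partialIsometry, ContinuousLinearMap.adjoint_comp,
    ContinuousLinearMap.adjoint_adjoint, partialIsometry]

theorem Orthonormal.partialIsometry_mul {a b d : J → H} (ha : Orthonormal ℂ a)
    (hb : Orthonormal ℂ b) (hd : Orthonormal ℂ d) :
    ha.partialIsometry hb * hb.partialIsometry hd = ha.partialIsometry hd := by
  refine ContinuousLinearMap.ext fun x => ?_
  exact congrArg ha.lpIsometry (hb.adjoint_lpIsometry_apply _)

end partialIsometries

section standardBasis

variable {I : Type*}

open scoped Classical in
/-- The standard basis of `ℓ²(I)`. -/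
def lpBasis (i : I) : lp (fun _ : I => ℂ) 2 := lp.single 2 i 1

theorem orthonormal_lpBasis : Orthonormal ℂ (lpBasis : I → lp (fun _ : I => ℂ) 2) := by
  classical
  rw [orthonormal_iff_ite]
  intro i j
  rw [lpBasis, lpBasis, lp.inner_single_left, lp.single_apply]
  simp [Pi.single_apply]

theorem lp_hom_ext {H : Type*} [NormedAddCommGroup H] [NormedSpace ℂ H]
    {S T : lp (fun _ : I => ℂ) 2 →L[ℂ] H} (h : ∀ i, S (lpBasis i) = T (lpBasis i)) : S = T := by
  classical
  refine lp.ext_continuousLinearMap (by norm_num) fun i => ?_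
  refine ContinuousLinearMap.ext_ring ?_
  exact h i

theorem orthonormal_phase_lpBasis {J : Type*} {f : J → I} (hf : Function.Injective f)
    (p : J → Circle) : Orthonormal ℂ fun j => (p j : ℂ) • lpBasis (f j) := by
  refine ⟨fun j => ?_, fun i j hij => ?_⟩
  · rw [norm_smul, Circle.norm_coe, one_mul, orthonormal_lpBasis.1]
  · change inner ℂ _ _ = _
    rw [inner_smul_left, inner_smul_right, orthonormal_lpBasis.2 (hf.ne hij), mul_zero, mul_zero]

end standardBasis

/-! ### Cuntz–Krieger families from twisted actions -/

namespace KGraph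

variable {k : ℕ} {Λ : KGraph.{u} k}

/-- An action of `Λ` on a bundle `X` of sets over the vertices, with the unique factorisation
property, together with phases that implement the cocycle `c`. -/
structure TwistedAction (c : Λ.TwoCocycle) where
  X : Λ.Obj → Type v
  act : ∀ ⦃a b : Λ.Obj⦄, (a ⟶ b) → X a → X b
  phase : ∀ ⦃a b : Λ.Obj⦄, (a ⟶ b) → X a → Circle
  act_id : ∀ (a : Λ.Obj) (x : X a), act (𝟙 a) x = x
  act_comp : ∀ ⦃a b e : Λ.Obj⦄ (μ : b ⟶ a) (ν : e ⟶ b) (x : X e),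
    act (ν ≫ μ) x = act μ (act ν x)
  phase_comp : ∀ ⦃a b e : Λ.Obj⦄ (μ : b ⟶ a) (ν : e ⟶ b) (x : X e),
    phase μ (act ν x) * phase ν x = c μ ν * phase (ν ≫ μ) x
  factor : ∀ (v : Λ.Obj) (n : Fin k → ℕ) (y : X v),
    ∃! p : Σ α : Λ.PathTo v n, X α.1, act p.1.2.1 p.2 = y

namespace TwistedAction

variable {c : Λ.TwoCocycle} (𝒳 : TwistedAction.{u, v} c)

theorem act_injective ⦃a b : Λ.Obj⦄ (l : a ⟶ b) : Function.Injective (𝒳.act l) := by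
  intro x y hxy
  have := (𝒳.factor b (Λ.deg l) (𝒳.act l y)).unique
    (y₁ := ⟨⟨a, l, rfl⟩, x⟩) (y₂ := ⟨⟨a, l, rfl⟩, y⟩) hxy rfl
  exact eq_of_heq (Sigma.mk.inj_iff.1 this).2

theorem phase_id (a : Λ.Obj) (x : 𝒳.X a) : 𝒳.phase (𝟙 a) x = 1 := by
  have := 𝒳.phase_comp (𝟙 a) (𝟙 a) x
  rw [c.id_left, Category.comp_id, 𝒳.act_id, one_mul] at this
  exact mul_eq_right.1 this

/-- The Hilbert space with one basis vector for each point of the bundle. -/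
abbrev Space : Type _ := lp (fun _ : Σ a : Λ.Obj, 𝒳.X a => ℂ) 2

theorem orthonormal_image ⦃a b : Λ.Obj⦄ (l : a ⟶ b) :
    Orthonormal ℂ fun x : 𝒳.X a =>
      (𝒳.phase l x : ℂ) • (lpBasis (⟨b, 𝒳.act l x⟩ : Σ a : Λ.Obj, 𝒳.X a)) :=
  orthonormal_phase_lpBasis (f := fun x : 𝒳.X a => (⟨b, 𝒳.act l x⟩ : Σ a : Λ.Obj, 𝒳.X a))
    (fun _ _ h => 𝒳.act_injective l (eq_of_heq (Sigma.mk.inj_iff.1 h).2)) _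

theorem orthonormal_fibre (a : Λ.Obj) :
    Orthonormal ℂ fun x : 𝒳.X a => (lpBasis (⟨a, x⟩ : Σ a : Λ.Obj, 𝒳.X a)) :=
  orthonormal_lpBasis.comp (fun x : 𝒳.X a => (⟨a, x⟩ : Σ a : Λ.Obj, 𝒳.X a))
    (fun _ _ h => eq_of_heq (Sigma.mk.inj_iff.1 h).2)

/-- The operator `e_x ↦ phase(l,x) e_{lx}`. -/
def op ⦃a b : Λ.Obj⦄ (l : a ⟶ b) : 𝒳.Space →L[ℂ] 𝒳.Space :=
  (𝒳.orthonormal_image l).partialIsometry (𝒳.orthonormal_fibre a)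

theorem op_apply ⦃a b : Λ.Obj⦄ (l : a ⟶ b) (x : 𝒳.X a) :
    𝒳.op l (lpBasis ⟨a, x⟩) = (𝒳.phase l x : ℂ) • lpBasis ⟨b, 𝒳.act l x⟩ :=
  (𝒳.orthonormal_image l).partialIsometry_apply (𝒳.orthonormal_fibre a) x

theorem op_apply_of_ne ⦃a b : Λ.Obj⦄ (l : a ⟶ b) {e : Λ.Obj} (h : e ≠ a) (x : 𝒳.X e) :
    𝒳.op l (lpBasis ⟨e, x⟩) = 0 :=
  (𝒳.orthonormal_image l).partialIsometry_apply_eq_zero (𝒳.orthonormal_fibre a) fun _ =>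
    orthonormal_lpBasis.2 fun h' => h (congrArg Sigma.fst h').symm

theorem op_id_eq (a : Λ.Obj) :
    𝒳.op (𝟙 a) = (𝒳.orthonormal_fibre a).partialIsometry (𝒳.orthonormal_fibre a) := by
  rw [op]
  congr 1
  funext x
  rw [𝒳.act_id, 𝒳.phase_id, Circle.coe_one, one_smul]

theorem op_id_apply (a : Λ.Obj) (x : 𝒳.X a) : 𝒳.op (𝟙 a) (lpBasis ⟨a, x⟩) = lpBasis ⟨a, x⟩ := by
  rw [op_apply, 𝒳.act_id, 𝒳.phase_id, Circle.coe_one, one_smul]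

theorem op_mul_star_eq ⦃a b : Λ.Obj⦄ (l : a ⟶ b) :
    𝒳.op l * star (𝒳.op l) =
      (𝒳.orthonormal_image l).partialIsometry (𝒳.orthonormal_image l) := by
  rw [op, Orthonormal.star_partialIsometry, Orthonormal.partialIsometry_mul]

theorem op_mul_star_apply ⦃a b : Λ.Obj⦄ (l : a ⟶ b) (x : 𝒳.X a) :
    (𝒳.op l * star (𝒳.op l)) (lpBasis ⟨b, 𝒳.act l x⟩) = lpBasis ⟨b, 𝒳.act l x⟩ := by
  have h := (𝒳.orthonormal_image l).partialIsometry_apply (𝒳.orthonormal_image l) x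
  rw [← op_mul_star_eq, map_smul] at h
  -- The partial isometry fixes the basis vector times a unimodular phase, and this phase cancels.
  exact smul_right_injective _ (Circle.coe_ne_zero (𝒳.phase l x)) h

theorem op_mul_star_apply_eq_zero ⦃a b : Λ.Obj⦄ (l : a ⟶ b) (y : Σ a : Λ.Obj, 𝒳.X a)
    (hy : ∀ x, (⟨b, 𝒳.act l x⟩ : Σ a : Λ.Obj, 𝒳.X a) ≠ y) :
    (𝒳.op l * star (𝒳.op l)) (lpBasis y) = 0 := by
  rw [op_mul_star_eq]
  refine Orthonormal.partialIsometry_apply_eq_zero _ _ fun x => ?_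
  rw [inner_smul_left, orthonormal_lpBasis.2 (hy x), mul_zero]

/-- The Cuntz–Krieger family defined by a twisted action. -/
def family [Λ.RowFinite] : CKFamily c (𝒳.Space →L[ℂ] 𝒳.Space) where
  toFun a b l := 𝒳.op l
  ck1_proj a := by
    rw [op_id_eq]
    exact ⟨Orthonormal.partialIsometry_mul _ _ _, Orthonormal.star_partialIsometry _ _⟩
  ck1_orth a b h := by
    refine lp_hom_ext fun ⟨e, x⟩ => ?_
    change 𝒳.op (𝟙 a) (𝒳.op (𝟙 b) (lpBasis ⟨e, x⟩)) = 0
    by_cases he : e = b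
    · subst he
      rw [op_id_apply, op_apply_of_ne _ _ h.symm]
    · rw [𝒳.op_apply_of_ne _ he, map_zero]
  ck2 a b e μ ν := by
    refine lp_hom_ext fun ⟨f, x⟩ => ?_
    change 𝒳.op μ (𝒳.op ν (lpBasis ⟨f, x⟩)) = (c μ ν : ℂ) • 𝒳.op (ν ≫ μ) (lpBasis ⟨f, x⟩)
    by_cases hf : f = e
    · subst hf
      rw [op_apply, map_smul, op_apply, op_apply, 𝒳.act_comp, smul_smul, smul_smul,
        ← Circle.coe_mul, ← Circle.coe_mul, ← 𝒳.phase_comp, mul_comm]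
    · rw [𝒳.op_apply_of_ne _ hf, 𝒳.op_apply_of_ne _ hf, map_zero, smul_zero]
  ck3 a b l := by
    rw [op_id_eq, op, Orthonormal.star_partialIsometry, Orthonormal.partialIsometry_mul]
  ck4 v n := by
    refine lp_hom_ext fun ⟨e, y⟩ => ?_
    rw [sum_apply]
    by_cases he : e = v
    · subst he
      -- The point y is αx for exactly one α of degree n, so exactly one range projection in the CK4
      -- sum fixes its basis vector and the others kill it.
      obtain ⟨⟨α, x⟩, hx, huniq⟩ := 𝒳.factor e n y
      have hx : 𝒳.act α.2.1 x = y := hx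
      subst hx
      rw [Finset.sum_eq_single α, op_mul_star_apply, op_id_apply]
      · intro β _ hβ
        refine op_mul_star_apply_eq_zero _ _ _ fun z hz => hβ ?_
        exact congrArg Sigma.fst (huniq ⟨β, z⟩ (eq_of_heq (Sigma.mk.inj_iff.1 hz).2))
      · exact fun h => absurd (Finset.mem_univ _) h
    · rw [𝒳.op_apply_of_ne _ he, Finset.sum_eq_zero]
      intro α _
      exact op_mul_star_apply_eq_zero _ _ _ fun z hz => he (congrArg Sigma.fst hz).symm

theorem family_vertex_ne_zero [Λ.RowFinite] {a : Λ.Obj} (x : 𝒳.X a) : 𝒳.family (𝟙 a) ≠ 0 := by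
  intro h
  have h1 : 𝒳.op (𝟙 a) (lpBasis ⟨a, x⟩) = 0 := by
    change 𝒳.family (𝟙 a) (lpBasis ⟨a, x⟩) = 0
    rw [h, zero_apply]
  rw [op_id_apply] at h1
  exact orthonormal_lpBasis.ne_zero _ h1

end TwistedAction

end KGraph

namespace KGraph

variable {k : ℕ} {Λ : KGraph.{u} k}

/-! ### The twisted action on the paths that end in a given tail -/

namespace Tail

variable (E : ℕᵒᵖ ⥤ Λ.Obj)

/-- The segment from `N` to `j` of the tail `E`. -/
abbrev seg {j N : ℕ} (h : j ≤ N) : E.obj (.op N) ⟶ E.obj (.op j) := E.map (homOfLE h).op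

theorem seg_comp {j N M : ℕ} (h : j ≤ N) (h' : N ≤ M) :
    seg E h' ≫ seg E h = seg E (h.trans h') := by
  rw [← E.map_comp]
  rfl

/-- The paths with range `b` whose source lies on the tail. -/
abbrev Start (b : Λ.Obj) : Type u := Σ j : ℕ, (E.obj (.op j) ⟶ b)

variable {E}

/-- A path prolonged along the tail. -/
def push {b : Λ.Obj} (z : Start E b) {N : ℕ} (h : z.1 ≤ N) : Start E b := ⟨N, seg E h ≫ z.2⟩

theorem push_push {b : Λ.Obj} (z : Start E b) {N M : ℕ} (h : z.1 ≤ N) (h' : N ≤ M) :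
    push (push z h) h' = push z (h.trans h') := by
  simp only [push, ← Category.assoc, seg_comp]

theorem push_eq_push_of_le {b : Λ.Obj} {z z' : Start E b} {N M : ℕ} {h : z.1 ≤ N} {h' : z'.1 ≤ N}
    (e : push z h = push z' h') (hNM : N ≤ M) :
    push z (h.trans hNM) = push z' (h'.trans hNM) := by
  have congr : ∀ {y y' : Start E b} (_ : y = y') (g : y.1 ≤ M) (g' : y'.1 ≤ M),
      push y g = push y' g' := by
    rintro y _ rfl g g'
    rfl
  exact (push_push z h hNM).symm.trans ((congr e hNM hNM).trans (push_push z' h' hNM))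

/-- The path `lz`. -/
def prepend {a b : Λ.Obj} (l : a ⟶ b) (z : Start E a) : Start E b := ⟨z.1, z.2 ≫ l⟩

theorem prepend_push {a b : Λ.Obj} (l : a ⟶ b) (z : Start E a) {N : ℕ} (h : z.1 ≤ N) :
    prepend l (push z h) = push (prepend l z) h := by
  simp only [push, prepend, Category.assoc]

variable (E) in
/-- Two paths are equivalent if they agree when they are prolonged along the tail. -/
def setoid (b : Λ.Obj) : Setoid (Start E b) where
  r z z' := ∃ (N : ℕ) (h : z.1 ≤ N) (h' : z'.1 ≤ N), push z h = push z' h'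
  iseqv :=
    { refl := fun z => ⟨z.1, le_rfl, le_rfl, rfl⟩
      symm := fun ⟨N, h, h', e⟩ => ⟨N, h', h, e.symm⟩
      trans := fun {x y z} ⟨N, h, h', e⟩ ⟨M, g, g', e'⟩ =>
        ⟨max N M, h.trans (le_max_left _ _), g'.trans (le_max_right _ _), by
          exact (push_eq_push_of_le e (le_max_left N M)).trans
            (push_eq_push_of_le e' (le_max_right N M))⟩ }

variable (E) in
/-- The infinite paths with range `b` that end in the tail `E`. -/
def Inf (b : Λ.Obj) : Type u := Quotient (setoid E b)

theorem mk_push {b : Λ.Obj} (z : Start E b) {N : ℕ} (h : z.1 ≤ N) :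
    Quotient.mk (setoid E b) (push z h) = Quotient.mk (setoid E b) z :=
  Quotient.sound (s := setoid E b) ⟨N, le_rfl, h, push_push z h le_rfl⟩

variable (c : Λ.TwoCocycle)

/-- The phase that relates a path to its prolongation along the tail. -/
def phase {b : Λ.Obj} (z : Start E b) {N : ℕ} (h : z.1 ≤ N) : Circle :=
  c z.2 (seg E h) * (c (seg E (Nat.zero_le z.1)) (seg E h))⁻¹

/-- The cocycle identity for z alone leaves an extra factor, the value of c on the two segments. The
same identity for the initial segment of the tail produces this factor too, and the quotient in the
definition of `phase` cancels it. -/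
theorem phase_mul_phase {b : Λ.Obj} (z : Start E b) {N M : ℕ} (h : z.1 ≤ N) (h' : N ≤ M) :
    phase c z h * phase c (push z h) h' = phase c z (h.trans h') := by
  have h1 := c.cocycle z.2 (seg E h) (seg E h')
  have h2 := c.cocycle (seg E (Nat.zero_le z.1)) (seg E h) (seg E h')
  rw [seg_comp] at h1 h2
  rw [seg_comp] at h2
  change c z.2 (seg E h) * (c (seg E (Nat.zero_le z.1)) (seg E h))⁻¹ *
    (c (seg E h ≫ z.2) (seg E h') * (c (seg E (Nat.zero_le N)) (seg E h'))⁻¹) =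
    c z.2 (seg E (h.trans h')) * (c (seg E (Nat.zero_le z.1)) (seg E (h.trans h')))⁻¹
  rw [mul_mul_mul_comm, ← mul_inv, h1, h2, mul_inv, mul_mul_mul_comm, mul_inv_cancel, one_mul]

theorem phase_congr {b : Λ.Obj} {z z' : Start E b} (e : z = z') {N : ℕ} (h : z.1 ≤ N)
    (h' : z'.1 ≤ N) : phase c z h = phase c z' h' := by
  subst e
  rfl

/-- The function g compares z with a chosen representative of its class: both are prolonged until
they agree, and the quotient of the two phases is taken. The prolongation z·E has the same
representative, so g changes by exactly the phase of the prolongation. -/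
theorem exists_phase_div (b : Λ.Obj) : ∃ g : Start E b → Circle,
    ∀ (z : Start E b) (N : ℕ) (h : z.1 ≤ N), g z = phase c z h * g (push z h) := by
  let o : Start E b → Start E b := fun z => (Quotient.mk (setoid E b) z).out
  have ho : ∀ z, ∃ (N : ℕ) (h : z.1 ≤ N) (h' : (o z).1 ≤ N), push z h = push (o z) h' :=
    fun z => Quotient.exact (s := setoid E b) (Quotient.out_eq _).symm
  choose n h₁ h₂ heq using ho
  -- The quotient does not depend on how far along the tail the comparison is made.
  have key : ∀ (z : Start E b) (M : ℕ) (h : n z ≤ M),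
      phase c z (h₁ z) * (phase c (o z) (h₂ z))⁻¹ =
        phase c z ((h₁ z).trans h) * (phase c (o z) ((h₂ z).trans h))⁻¹ := by
    intro z M h
    rw [← phase_mul_phase c z (h₁ z) h, ← phase_mul_phase c (o z) (h₂ z) h, mul_inv,
      mul_mul_mul_comm, phase_congr c (heq z) (N := M) h h, mul_inv_cancel, mul_one]
  refine ⟨fun z => phase c z (h₁ z) * (phase c (o z) (h₂ z))⁻¹, fun z N h => ?_⟩
  have h3 : o (push z h) = o z := by simp only [o, mk_push]
  have hN : N ≤ max (n z) (n (push z h)) := (h₁ (push z h)).trans (le_max_right _ _)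
  dsimp only
  rw [key z _ (le_max_left _ (n (push z h))), key (push z h) _ (le_max_right (n z) _), ← mul_assoc,
    phase_mul_phase c z h hN]
  congr 3
  exact h3.symm

/-- Phases for which the vectors represented by the paths `z` and by their prolongations agree. -/
def trivialise {b : Λ.Obj} : Start E b → Circle := (exists_phase_div c b).choose

theorem trivialise_eq {b : Λ.Obj} (z : Start E b) {N : ℕ} (h : z.1 ≤ N) :
    trivialise c z = phase c z h * trivialise c (push z h) :=
  (exists_phase_div c b).choose_spec z N h

/-- The phase of the action of the path `l`. -/
def actPhase {a b : Λ.Obj} (l : a ⟶ b) (z : Start E a) : Circle :=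
  (trivialise c z)⁻¹ * c l z.2 * trivialise c (prepend l z)

theorem actPhase_push {a b : Λ.Obj} (l : a ⟶ b) (z : Start E a) {N : ℕ} (h : z.1 ≤ N) :
    actPhase c l (push z h) = actPhase c l z := by
  -- This is the cocycle identity for l, z and the segment; the factor that involves only the tail
  -- is common to both sides.
  have h1 : c l z.2 * phase c (prepend l z) h = phase c z h * c l (push z h).2 := by
    change c l z.2 * (c (z.2 ≫ l) (seg E h) * (c (seg E (Nat.zero_le z.1)) (seg E h))⁻¹) =
      c z.2 (seg E h) * (c (seg E (Nat.zero_le z.1)) (seg E h))⁻¹ * c l (seg E h ≫ z.2)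
    rw [← mul_assoc, c.cocycle, mul_right_comm]
  rw [actPhase, actPhase, trivialise_eq c z h, trivialise_eq c (prepend l z) (N := N) h,
    prepend_push, mul_inv]
  generalize c l (push z h).2 = x at h1 ⊢
  generalize c l z.2 = q at h1 ⊢
  generalize phase c (prepend l z) h = s at h1 ⊢
  generalize trivialise c (push (prepend l z) h) = y
  generalize trivialise c (push z h) = t
  generalize phase c z h = p at h1 ⊢
  calc t⁻¹ * x * y = t⁻¹ * x * y * (p⁻¹ * p) := by rw [inv_mul_cancel, mul_one]
    _ = p⁻¹ * t⁻¹ * (p * x) * y := by ac_rfl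
    _ = _ := by rw [← h1]; ac_rfl

/-- The action of `Λ` on the infinite paths that end in the tail `E`. -/
def action (hE : ∀ (j : ℕ) (n : Fin k → ℕ), ∃ (N : ℕ) (h : j ≤ N), n ≤ Λ.deg (seg E h)) :
    TwistedAction.{u, u} c where
  X := Inf E
  act a b l := Quotient.map' (s₁ := setoid E a) (s₂ := setoid E b) (prepend l)
    fun z z' ⟨N, h, h', e⟩ => ⟨N, h, h', by
      have := congrArg (prepend l) e
      rwa [prepend_push, prepend_push] at this⟩
  phase a b l := Quotient.lift (s := setoid E a) (actPhase c l) fun z z' ⟨N, h, h', e⟩ => by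
    rw [← actPhase_push c l z h, ← actPhase_push c l z' h', e]
  act_id a x := by
    induction x using Quotient.inductionOn with
    | h z =>
      refine congrArg (Quotient.mk (setoid E a)) ?_
      simp only [prepend, Category.comp_id]
  act_comp a b e μ ν x := by
    induction x using Quotient.inductionOn with
    | h z =>
      refine congrArg (Quotient.mk (setoid E a)) ?_
      simp only [prepend, Category.assoc]
  phase_comp a b e μ ν x := by
    induction x using Quotient.inductionOn with
    | h z =>
      change actPhase c μ (prepend ν z) * actPhase c ν z = c μ ν * actPhase c (ν ≫ μ) z
      have h1 : prepend μ (prepend ν z) = prepend (ν ≫ μ) z := by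
        simp only [prepend, Category.assoc]
      -- The trivialising phases telescope in the product of the two action phases, and what remains
      -- is the cocycle identity.
      have h2 : c μ ν * c (ν ≫ μ) z.2 = c ν z.2 * c μ (prepend ν z).2 := c.cocycle μ ν z.2
      rw [actPhase, actPhase, actPhase, h1]
      generalize trivialise c (prepend ν z) = x
      generalize trivialise c (prepend (ν ≫ μ) z) = y
      calc x⁻¹ * c μ (prepend ν z).2 * y * ((trivialise c z)⁻¹ * c ν z.2 * x)
          = (trivialise c z)⁻¹ * (c ν z.2 * c μ (prepend ν z).2) * y * (x⁻¹ * x) := by ac_rfl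
        _ = _ := by rw [← h2, inv_mul_cancel, mul_one]; ac_rfl
  factor b n y := by
    induction y using Quotient.inductionOn with
    | h z =>
      -- Far enough along the tail the path has degree at least n, and an initial piece of degree n
      -- can be split off.
      obtain ⟨N, h, hn⟩ := hE z.1 n
      have hdeg : Λ.deg (push z h).2 = n + (Λ.deg (push z h).2 - n) := by
        rw [add_tsub_cancel_of_le]
        change n ≤ Λ.deg (seg E h ≫ z.2)
        rw [Λ.deg_mul]
        exact hn.trans (le_add_of_nonneg_left bot_le)
      obtain ⟨⟨e, μ, ν⟩, ⟨h1, -, h3⟩, -⟩ := Λ.factorisation (push z h).2 _ _ hdeg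
      refine ⟨⟨⟨e, μ, h1⟩, Quotient.mk (setoid E e) ⟨N, ν⟩⟩, ?_, ?_⟩
      · rw [← mk_push z h]
        refine congrArg (Quotient.mk (setoid E b)) ?_
        change (⟨N, ν ≫ μ⟩ : Start E b) = ⟨N, (push z h).2⟩
        exact congrArg (Sigma.mk N) h3
      · rintro ⟨⟨e', μ', h1'⟩, y'⟩ hy
        induction y' using Quotient.inductionOn with
        | h z' =>
          obtain ⟨M, g, g', hM⟩ := Quotient.exact (s := setoid E b) (hy.trans (mk_push z h).symm)
          have hM' : seg E g ≫ z'.2 ≫ μ' = seg E g' ≫ (push z h).2 :=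
            eq_of_heq (Sigma.mk.inj_iff.1 hM).2
          have h3 : ν ≫ μ = (push z h).2 := h3
          rw [← h3] at hM'
          replace hM' : (seg E g ≫ z'.2) ≫ μ' = (seg E g' ≫ ν) ≫ μ :=
            (Category.assoc _ _ _).trans (hM'.trans (Category.assoc _ _ _).symm)
          have hd : Λ.deg (seg E g ≫ z'.2) = Λ.deg (seg E g' ≫ ν) := by
            have := congrArg (fun l => Λ.deg l) hM'
            simp only [Λ.deg_mul _ (seg E g ≫ z'.2), Λ.deg_mul _ (seg E g' ≫ ν)] at this
            have h1 : Λ.deg μ = n := h1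
            rw [h1, h1'] at this
            exact add_left_cancel this
          -- Two factorisations of the same infinite path agree after prolongation, so unique
          -- factorisation in Λ identifies the initial pieces, and the remainders are equivalent.
          have := (Λ.factorisation ((seg E g' ≫ ν) ≫ μ) _ _ (Λ.deg_mul _ _)).unique
            (y₁ := ⟨e', μ', seg E g ≫ z'.2⟩) (y₂ := ⟨e, μ, seg E g' ≫ ν⟩)
            ⟨h1'.trans h1.symm, hd, hM'⟩ ⟨rfl, rfl, rfl⟩
          obtain ⟨rfl, this⟩ := Sigma.mk.inj_iff.1 this
          obtain ⟨rfl, h5⟩ := Prod.mk_inj.1 (eq_of_heq this)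
          congr 1
          exact Quotient.sound (s := setoid E e') ⟨M, g, g', congrArg (Sigma.mk M) h5⟩

end Tail

/-! ### Tails of infinite degree and nonvanishing of the vertex projections -/

variable [Λ.NoSources]

/-- Vertices `v = v₀, v₁, v₂, …` with a path of degree `(1, …, 1)` from `v_{j+1}` to `v_j`. -/
def tailVertex (v : Λ.Obj) : ℕ → Λ.Obj
  | 0 => v
  | j + 1 => (Classical.choice (NoSources.nonempty_pathTo (tailVertex v j) fun _ => 1)).1

/-- The path of degree `(1, …, 1)` from `v_{j+1}` to `v_j`. -/
def tailEdge (v : Λ.Obj) (j : ℕ) :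
    {l : tailVertex v (j + 1) ⟶ tailVertex v j // Λ.deg l = fun _ => 1} :=
  (Classical.choice (NoSources.nonempty_pathTo (tailVertex v j) fun _ => 1)).2

/-- A tail with range `v` and infinite degree. -/
def tail (v : Λ.Obj) : ℕᵒᵖ ⥤ Λ.Obj := Functor.ofOpSequence fun j => (tailEdge v j).1

theorem deg_seg_tail (v : Λ.Obj) (j r : ℕ) :
    Λ.deg (Tail.seg (tail v) (Nat.le_add_right j r)) = fun _ => r := by
  induction r with
  | zero =>
    have : Tail.seg (tail v) (Nat.le_add_right j 0) = 𝟙 _ := (tail v).map_id _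
    rw [this, Λ.deg_id]
    rfl
  | succ r ih =>
    have h1 : Λ.deg (Tail.seg (tail v) (Nat.le_succ (j + r))) = fun _ => 1 := by
      have : Tail.seg (tail v) (Nat.le_succ (j + r)) = (tailEdge v (j + r)).1 :=
        Functor.ofOpSequence_map_homOfLE_succ _ _
      rw [this]
      exact (tailEdge v (j + r)).2
    have h2 := Tail.seg_comp (tail v) (Nat.le_add_right j r) (Nat.le_succ (j + r))
    have h3 := congrArg (fun l => Λ.deg l) h2
    simp only [Λ.deg_mul, ih, h1] at h3
    exact h3.symm

theorem exists_le_deg_seg_tail (v : Λ.Obj) (j : ℕ) (n : Fin k → ℕ) :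
    ∃ (N : ℕ) (h : j ≤ N), n ≤ Λ.deg (Tail.seg (tail v) h) :=
  ⟨j + ∑ i, n i, Nat.le_add_right _ _, by
    rw [deg_seg_tail]
    exact fun i => Finset.single_le_sum (f := n) (fun _ _ => Nat.zero_le _) (Finset.mem_univ i)⟩

/-- In the representation on the infinite paths that end in the tail at v, the image of s_v fixes
the basis vector of the tail itself. -/
theorem univ_vertex_ne_zero [Λ.RowFinite] (c : Λ.TwoCocycle) (v : Λ.Obj) : univ c (𝟙 v) ≠ 0 := by
  intro h
  let 𝒳 := Tail.action c (exists_le_deg_seg_tail v)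
  refine 𝒳.family_vertex_ne_zero (a := v)
    (Quotient.mk (Tail.setoid (tail v) v) ⟨0, 𝟙 v⟩) ?_
  rw [← lift_univ, h, map_zero]

end KGraph

/-! ### Spans of matrix units under homomorphisms and phases -/

theorem IsMatrixUnits.image_subalgebra {E I : Type*} {A : Type v} {B : Type w}
    [NonUnitalCStarAlgebra A] [NonUnitalCStarAlgebra B] {col : E → I} {θ : E → E → A}
    (h : IsMatrixUnits col θ) (φ : A →⋆ₙₐ[ℂ] B) (F : Set E) :
    φ '' (h.subalgebra F : Set A) = ((h.map φ).subalgebra F : Set B) := by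
  have key := Submodule.map_span (φ : A →ₗ[ℂ] B) (Set.image2 θ F F)
  have key2 := congrArg (fun S : Submodule ℂ B => (S : Set B)) key
  simp only [Submodule.map_coe] at key2
  refine key2.trans ?_
  exact congrArg (fun S : Set B => (Submodule.span ℂ S : Set B))
    (Set.image_image2 θ (fun x => φ x))

theorem IsMatrixUnits.subalgebra_phase {E I : Type*} {A : Type v}
    [NonUnitalCStarAlgebra A] {col : E → I} {θ : E → E → A}
    (h : IsMatrixUnits col θ) (p : E → Circle) (F : Set E) :
    (h.phase p).subalgebra F = h.subalgebra F := by
  refine le_antisymm ((h.phase p).subalgebra_le fun x hx y hy =>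
    SMulMemClass.smul_mem _ (h.unit_mem_subalgebra hx hy))
    (h.subalgebra_le fun x hx y hy => ?_)
  have := SMulMemClass.smul_mem (((p x * (p y)⁻¹)⁻¹ : Circle) : ℂ)
    ((h.phase p).unit_mem_subalgebra hx hy)
  rwa [smul_smul, ← Circle.coe_mul, inv_mul_cancel, Circle.coe_one, one_smul] at this

namespace KGraph

variable {k : ℕ} {Λ : KGraph.{u} k} [Λ.RowFinite] (c : Λ.TwoCocycle)

/-! ### The fixed-point algebra of the gauge action -/

theorem gauge_mul_star (z : Fin k → Circle) ⦃a b a' b' : Λ.Obj⦄ (μ : a ⟶ b) (ν : a' ⟶ b') :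
    gauge c z (univ c μ * star (univ c ν)) =
      (((∏ i, z i ^ Λ.deg μ i) * (∏ i, z i ^ Λ.deg ν i)⁻¹ : Circle) : ℂ) •
        (univ c μ * star (univ c ν)) := by
  rw [map_mul, map_star, gauge_univ, gauge_univ, star_smul, smul_mul_smul_comm, Circle.coe_mul,
    Circle.coe_inv_eq_conj]
  rfl

theorem level_le_fixedPoints (n : Fin k → ℕ) : (univ c).level n ≤ fixedPoints c := by
  refine ((univ c).isMatrixUnits_unit n).subalgebra_le fun p _ q _ z => ?_
  rw [CKFamily.unit, gauge_mul_star, p.2.2.2, q.2.2.2, mul_inv_cancel, Circle.coe_one, one_smul]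

theorem exists_character_eq_neg_one {m n : Fin k → ℕ} (h : m ≠ n) :
    ∃ z : Fin k → Circle, (((∏ i, z i ^ m i) * (∏ i, z i ^ n i)⁻¹ : Circle) : ℂ) = -1 := by
  obtain ⟨i, hi⟩ := Function.ne_iff.1 h
  have hi' : (m i : ℝ) - n i ≠ 0 := sub_ne_zero.2 (Nat.cast_injective.ne hi)
  -- Only a coordinate i with m i ≠ n i is rotated, by the angle that makes z^(m - n) equal to
  -- exp(iπ).
  refine ⟨Pi.mulSingle i (Circle.exp (Real.pi / (m i - n i))), ?_⟩
  have key : ∀ (e : Fin k → ℕ) (w : Circle),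
      ∏ j, (Pi.mulSingle i w : Fin k → Circle) j ^ e j = w ^ e i := by
    intro e w
    rw [Finset.prod_eq_single i (fun j _ hj => by rw [Pi.mulSingle_eq_of_ne hj, one_pow])
      (fun h => absurd (Finset.mem_univ i) h), Pi.mulSingle_eq_same]
  rw [key, key, ← Circle.exp_natCast_mul, ← Circle.exp_natCast_mul, ← Circle.exp_neg,
    ← Circle.exp_add,
    show (m i : ℝ) * (Real.pi / (m i - n i)) + -(n i * (Real.pi / (m i - n i))) = Real.pi by
      field_simp; ring, Circle.coe_exp, Complex.exp_pi_mul_I]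

/-- The homogeneous elements of nonzero degree: each gauge automorphism acts as a scalar, and one
of them as `-1`. -/
def IsOffDiagonal (y : CStar c) : Prop :=
  (∃ z, gauge c z y = -y) ∧ ∀ z, ∃ r : ℂ, gauge c z y = r • y

variable {c}

theorem IsOffDiagonal.smul {y : CStar c} (hy : IsOffDiagonal c y) (r : ℂ) :
    IsOffDiagonal c (r • y) := by
  obtain ⟨⟨z, hz⟩, h⟩ := hy
  refine ⟨⟨z, by rw [map_smul, hz, smul_neg]⟩, fun z => ?_⟩
  obtain ⟨s, hs⟩ := h z
  exact ⟨s, by rw [map_smul, hs, smul_comm]⟩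

theorem IsOffDiagonal.exists_list_add {L : List (CStar c)}
    (hL : ∀ y ∈ L, IsOffDiagonal c y) (z : Fin k → Circle) :
    ∃ L' : List (CStar c), L'.length = L.length ∧ (∀ y ∈ L', IsOffDiagonal c y) ∧
      L'.sum = (1 / 2 : ℂ) • (L.sum + gauge c z L.sum) := by
  induction L with
  | nil => exact ⟨[], rfl, by simp, by simp⟩
  | cons y L ih =>
    obtain ⟨L', h1, h2, h3⟩ := ih fun y hy => hL y (List.mem_cons_of_mem _ hy)
    refine ⟨((1 / 2 : ℂ) • (y + gauge c z y)) :: L', by simp [h1], ?_, ?_⟩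
    · intro x hx
      rcases List.mem_cons.1 hx with rfl | hx
      · obtain ⟨r, hr⟩ := (hL y List.mem_cons_self).2 z
        -- Averaging multiplies y by (1 + r) / 2, so the average is again off-diagonal, possibly
        -- zero.
        rw [hr, show y + r • y = (1 + r) • y by rw [add_smul, one_smul], smul_smul]
        exact (hL y List.mem_cons_self).smul _
      · exact h2 x hx
    · rw [List.sum_cons, List.sum_cons, h3, map_add, ← smul_add]
      congr 1
      abel

/-- Averaging over the gauge action removes the off-diagonal part of an approximant to a fixed
point. -/
theorem exists_norm_sub_le_of_fixed {x : CStar c} (hx : x ∈ fixedPoints c) {b : CStar c}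
    (hb : b ∈ fixedPoints c) (n : ℕ) : ∀ L : List (CStar c), L.length = n →
      (∀ y ∈ L, IsOffDiagonal c y) → ‖x - b‖ ≤ ‖x - (b + L.sum)‖ := by
  induction n with
  | zero =>
    intro L hL _
    rw [List.length_eq_zero_iff.1 hL, List.sum_nil, add_zero]
  | succ n ih =>
    intro L hn hL
    obtain ⟨y, L, rfl⟩ := List.exists_cons_of_length_eq_add_one hn
    obtain ⟨z, hz⟩ := (hL y List.mem_cons_self).1
    obtain ⟨L', h1, h2, h3⟩ := IsOffDiagonal.exists_list_add
      (fun y hy => hL y (List.mem_cons_of_mem _ hy)) z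
    have hlen : L'.length = n := by rw [h1]; simpa using hn
    refine (ih L' hlen h2).trans ?_
    set w := x - (b + (y :: L).sum) with hw
    -- Here γ_z fixes x and b and negates y, so the average of w and γ_z(w) no longer contains y.
    -- Since γ_z is contractive, the norm does not grow, and one term of the list has been removed.
    have havg : x - (b + L'.sum) = (1 / 2 : ℂ) • (w + gauge c z w) := by
      have hg : gauge c z w = x - (b + (-y + gauge c z L.sum)) := by
        rw [hw, List.sum_cons, map_sub, map_add, map_add, hx z, hb z, hz]
      rw [hg, hw, h3, List.sum_cons]
      module
    rw [havg, norm_smul]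
    have h4 : ‖gauge c z w‖ ≤ ‖w‖ := NonUnitalStarAlgHom.norm_apply_le (gauge c z) w
    have h5 := norm_add_le w (gauge c z w)
    have h6 : ‖(1 / 2 : ℂ)‖ = 1 / 2 := by norm_num
    rw [h6]
    linarith

/-- Monomials s_μ s_ν* with d(μ) = d(ν) are collected in one level, using that levels increase; the
others are homogeneous of nonzero degree. -/
theorem exists_eq_add_sum_of_mem_monomialSpan {w : CStar c} (hw : w ∈ (univ c).monomialSpan) :
    ∃ (n : Fin k → ℕ) (b : CStar c) (L : List (CStar c)), b ∈ (univ c).level n ∧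
      (∀ y ∈ L, IsOffDiagonal c y) ∧ w = b + L.sum := by
  change w ∈ Submodule.span ℂ _ at hw
  induction hw using Submodule.span_induction with
  | mem w hw =>
    obtain ⟨a, b, b', μ, ν, rfl⟩ := hw
    by_cases h : Λ.deg μ = Λ.deg ν
    · exact ⟨Λ.deg μ, _, [], (univ c).unit_mem_level _ ⟨a, b, μ, rfl⟩ ⟨a, b', ν, h.symm⟩, by simp,
        (add_zero _).symm⟩
    · refine ⟨0, 0, [univ c μ * star (univ c ν)], zero_mem _, ?_, by simp⟩
      intro y hy
      rw [List.mem_singleton.1 hy]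
      refine ⟨?_, fun z => ⟨_, gauge_mul_star c z μ ν⟩⟩
      obtain ⟨z, hz⟩ := exists_character_eq_neg_one h
      exact ⟨z, by rw [gauge_mul_star, hz, neg_one_smul]⟩
  | zero => exact ⟨0, 0, [], zero_mem _, by simp, by simp⟩
  | add x y _ _ hx hy =>
    obtain ⟨m, b, L, hb, hL, rfl⟩ := hx
    obtain ⟨n, b', L', hb', hL', rfl⟩ := hy
    refine ⟨m ⊔ n, b + b', L ++ L', add_mem ((univ c).level_mono le_sup_left hb)
      ((univ c).level_mono le_sup_right hb'), ?_, ?_⟩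
    · intro y hy
      rcases List.mem_append.1 hy with h | h
      exacts [hL y h, hL' y h]
    · rw [List.sum_append]
      abel
  | smul r x _ hx =>
    obtain ⟨n, b, L, hb, hL, rfl⟩ := hx
    refine ⟨n, r • b, L.map (r • ·), SMulMemClass.smul_mem r hb, ?_, ?_⟩
    · intro y hy
      obtain ⟨y, h, rfl⟩ := List.mem_map.1 hy
      exact (hL y h).smul r
    · rw [smul_add, List.smul_sum]

variable (c) in
theorem fixedPoints_eq_closure :
    (fixedPoints c : Set (CStar c)) = closure (⋃ n, ((univ c).level n : Set (CStar c))) := by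
  refine subset_antisymm (fun x hx => ?_) ?_
  · rw [Metric.mem_closure_iff]
    intro ε hε
    obtain ⟨w, hw, hxw⟩ := Metric.mem_closure_iff.1 (CStar.mem_closure_monomialSpan x) ε hε
    obtain ⟨n, b, L, hb, hL, rfl⟩ := exists_eq_add_sum_of_mem_monomialSpan hw
    refine ⟨b, Set.mem_iUnion.2 ⟨n, hb⟩, ?_⟩
    rw [dist_eq_norm] at hxw ⊢
    exact (exists_norm_sub_le_of_fixed hx (level_le_fixedPoints c n hb) _ L rfl hL).trans_lt hxw
  · refine closure_minimal (Set.iUnion_subset fun n => level_le_fixedPoints c n) ?_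
    infer_instance

theorem univ_vertex_mem_fixedPoints (v : Λ.Obj) : univ c (𝟙 v) ∈ fixedPoints c := fun z => by
  rw [gauge_univ, Λ.deg_id]
  simp

/-! ### Representations of the fixed-point algebra -/

theorem norm_lift_eq_of_mem_fixedPoints {B : Type w} [NonUnitalCStarAlgebra B] (t : CKFamily c B)
    (ht : ∀ v : Λ.Obj, t (𝟙 v) ≠ 0) {x : CStar c} (hx : x ∈ fixedPoints c) :
    ‖lift t x‖ = ‖x‖ := by
  refine (lift t).norm_map_of_mem_closure
    (S := ⋃ n, ((univ c).level n : Set (CStar c))) (fun y hy => ?_) ?_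
  · obtain ⟨n, hy⟩ := Set.mem_iUnion.1 hy
    refine ((univ c).isMatrixUnits_unit n).norm_map_eq (lift t) (fun p => ?_) hy
    have h := t.unit_self_ne_zero ht n p
    rwa [CKFamily.unit, ← lift_univ t, ← map_star, ← map_mul] at h
  · rw [← fixedPoints_eq_closure]
    exact hx

/-- One direction uses that s_v is a nonzero fixed point; the other holds because π_t is isometric
on fixed points. -/
theorem injOn_lift_iff [Λ.NoSources] {B : Type w} [NonUnitalCStarAlgebra B] (t : CKFamily c B) :
    Set.InjOn (lift t) (fixedPoints c) ↔ ∀ v : Λ.Obj, t (𝟙 v) ≠ 0 := by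
  constructor
  · intro h v hv
    refine univ_vertex_ne_zero c v (h (univ_vertex_mem_fixedPoints v) (zero_mem (fixedPoints c)) ?_)
    rw [lift_univ, hv, map_zero]
  · intro h x hx y hy hxy
    have := norm_lift_eq_of_mem_fixedPoints t h (sub_mem hx hy)
    rw [map_sub, hxy, sub_self, norm_zero] at this
    exact sub_eq_zero.1 (norm_eq_zero.1 this.symm)

/-! ### Approximation by finite-dimensional subalgebras -/

variable (c) in
/-- The subalgebra spanned by `s_μ s_ν*` for `μ`, `ν` in a finite subset of some `Λⁿ`. -/
def finiteLevel (S : Σ n : Fin k → ℕ, Finset (Λ.Path n)) : NonUnitalStarSubalgebra ℂ (CStar c) :=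
  ((univ c).isMatrixUnits_unit S.1).subalgebra (S.2 : Set (Λ.Path S.1))

theorem exists_finset_subalgebra_le {m n : Fin k → ℕ} (h : m ≤ n) (F : Finset (Λ.Path m)) :
    ∃ G : Finset (Λ.Path n), finiteLevel c ⟨m, F⟩ ≤ finiteLevel c ⟨n, G⟩ := by
  have hfin : (⋃ p ∈ (F : Set (Λ.Path m)),
      Set.range fun α => p.extend (add_tsub_cancel_of_le h) α).Finite :=
    F.finite_toSet.biUnion fun p _ => Set.finite_range _
  refine ⟨hfin.toFinset, ?_⟩
  rw [finiteLevel, finiteLevel, hfin.coe_toFinset]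
  exact (univ c).subalgebra_le_subalgebra_extend (add_tsub_cancel_of_le h) F

-- Two finite sets of paths, of degrees m and n, are both pushed to degree m ⊔ n, where they stay
-- finite by row-finiteness. Countably many such finite sets exist, so directedness yields the
-- increasing sequence of the AF property.
variable (c) in
theorem directed_finiteLevel : Directed (· ≤ ·) (finiteLevel c) := by
  classical
  rintro ⟨m, F⟩ ⟨n, G⟩
  obtain ⟨F', hF⟩ := exists_finset_subalgebra_le (c := c) (le_sup_left : m ≤ m ⊔ n) F
  obtain ⟨G', hG⟩ := exists_finset_subalgebra_le (c := c) (le_sup_right : n ≤ m ⊔ n) G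
  refine ⟨⟨m ⊔ n, F' ∪ G'⟩, hF.trans ?_, hG.trans ?_⟩
  · exact ((univ c).isMatrixUnits_unit (m ⊔ n)).subalgebra_mono (by simp)
  · exact ((univ c).isMatrixUnits_unit (m ⊔ n)).subalgebra_mono (by simp)

variable (c) in
theorem isAF_fixedPoints : IsAF (fixedPoints c) := by
  let _ : Encodable (Σ n : Fin k → ℕ, Finset (Λ.Path n)) := Encodable.ofCountable _
  let _ : Inhabited (Σ n : Fin k → ℕ, Finset (Λ.Path n)) := ⟨⟨0, ∅⟩⟩
  have hdir := directed_finiteLevel c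
  let ι : fixedPoints c →⋆ₙₐ[ℂ] CStar c := NonUnitalStarSubalgebraClass.subtype (fixedPoints c)
  refine ⟨fun j => (finiteLevel c (hdir.sequence _ j)).comap ι, ?_, ?_, ?_⟩
  · exact fun i j hij x hx => hdir.sequence_mono hij hx
  · intro j
    have := ((univ c).isMatrixUnits_unit (hdir.sequence _ j).1).finiteDimensional_subalgebra
      (hdir.sequence _ j).2.finite_toSet
    let f : (finiteLevel c (hdir.sequence _ j)).comap ι →ₗ[ℂ]
        (((univ c).isMatrixUnits_unit (hdir.sequence _ j).1).subalgebra
          ((hdir.sequence _ j).2 : Set (Λ.Path (hdir.sequence _ j).1))) :=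
      { toFun := fun x => ⟨x.1.1, x.2⟩
        map_add' := fun _ _ => rfl
        map_smul' := fun _ _ => rfl }
    refine FiniteDimensional.of_injective f fun x y hxy => Subtype.ext (Subtype.ext ?_)
    have h : (f x).1 = (f y).1 := by rw [hxy]
    exact h
  · intro x
    rw [closure_subtype]
    have hx : (x : CStar c) ∈ closure (⋃ n, ((univ c).level n : Set (CStar c))) := by
      rw [← fixedPoints_eq_closure]
      exact x.2
    refine closure_mono ?_ hx
    refine Set.iUnion_subset fun n y hy => ?_
    obtain ⟨G, hG⟩ := ((univ c).isMatrixUnits_unit n).exists_finset_of_mem hy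
    refine ⟨⟨y, level_le_fixedPoints c n hy⟩, Set.mem_iUnion.2
      -- The directed sequence dominates the member with code e from its term e + 1 on.
      ⟨Encodable.encode (⟨n, G⟩ : Σ n : Fin k → ℕ, Finset (Λ.Path n)) + 1, ?_⟩, rfl⟩
    exact hdir.le_sequence ⟨n, G⟩ hG

end KGraph

namespace KGraph

variable {k : ℕ} {Λ : KGraph.{u} k}

/-! ### Independence of the cocycle -/

/-- Phases on the paths of degree `(j, …, j)` that compare the cocycles `c₁` and `c₂`. -/
theorem exists_comparison_phase (c₁ c₂ : Λ.TwoCocycle) :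
    ∃ p : ∀ j : ℕ, Λ.Path (fun _ : Fin k => j) → Circle,
      ∀ (j : ℕ) (h : ((fun _ => j) + fun _ => 1 : Fin k → ℕ) = fun _ => j + 1)
        (q : Λ.Path fun _ : Fin k => j) (α : Λ.PathTo q.1 fun _ => 1),
        p (j + 1) (q.extend h α) = p j q * c₂ q.2.2.1 α.2.1 * (c₁ q.2.2.1 α.2.1)⁻¹ := by
  have hadd : ∀ j : ℕ, ((fun _ => j) + fun _ => 1 : Fin k → ℕ) = fun _ => j + 1 := fun _ => rfl
  choose f g hfg using fun j => Path.extend_surjective (Λ := Λ) (hadd j)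
  -- Each path of degree (j + 1, …, j + 1) is split once and for all as a path of degree (j, …, j)
  -- followed by one of degree (1, …, 1). By unique factorisation the recursion then holds for every
  -- such splitting.
  let p : ∀ j : ℕ, Λ.Path (fun _ : Fin k => j) → Circle := fun j => Nat.rec (fun _ => 1)
    (fun j p q => p (f j q) * c₂ (f j q).2.2.1 (g j q).2.1 * (c₁ (f j q).2.2.1 (g j q).2.1)⁻¹) j
  refine ⟨p, fun j h q α => ?_⟩
  have hinj := Path.extend_injective (hadd j) (a₁ := ⟨_, g j (q.extend h α)⟩) (a₂ := ⟨q, α⟩)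
    (hfg j (q.extend h α))
  exact congrArg (fun x : Σ p : Λ.Path (fun _ : Fin k => j), Λ.PathTo p.1 fun _ => 1 =>
    p j x.1 * c₂ x.1.2.2.1 x.2.2.1 * (c₁ x.1.2.2.1 x.2.2.1)⁻¹) hinj

variable [Λ.RowFinite]

/-- The degrees (j, …, j) are cofinal in ℕᵏ, which reduces the comparison of two cocycles to a
sequence. -/
theorem closure_iUnion_level_diagonal (c : Λ.TwoCocycle) :
    closure (⋃ j : ℕ, ((univ c).level (fun _ => j) : Set (CStar c))) = fixedPoints c := by
  rw [fixedPoints_eq_closure]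
  congr 1
  refine subset_antisymm (Set.iUnion_subset fun j => Set.subset_iUnion
    (fun n => ((univ c).level n : Set (CStar c))) fun _ => j) (Set.iUnion_subset fun n => ?_)
  have h : n ≤ fun _ => ∑ i, n i :=
    fun i => Finset.single_le_sum (f := n) (fun _ _ => Nat.zero_le _) (Finset.mem_univ i)
  exact fun x hx => Set.mem_iUnion.2 ⟨_, (univ c).level_mono h hx⟩

theorem nonempty_fixedPoints_starAlgEquiv [Λ.NoSources] (c₁ c₂ : Λ.TwoCocycle) :
    Nonempty (fixedPoints c₁ ≃⋆ₐ[ℂ] fixedPoints c₂) := by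
  obtain ⟨p, hp⟩ := exists_comparison_phase c₁ c₂
  have h₁ := fun j : ℕ => (univ c₁).isMatrixUnits_unit fun _ => j
  have h₂ := fun j : ℕ => ((univ c₂).isMatrixUnits_unit fun _ => j).phase (p j)
  have h := fun j : ℕ => (h₁ j).prodMk (h₂ j)
  let W : ℕ → NonUnitalStarSubalgebra ℂ (CStar c₁ × CStar c₂) :=
    fun j => (h j).subalgebra Set.univ
  have hW : Monotone W := by
    refine monotone_nat_of_le_succ fun j => (h j).subalgebra_le fun q _ r _ => ?_
    by_cases hqr : q.1 = r.1
    · have hadd : ((fun _ => j) + fun _ => 1 : Fin k → ℕ) = fun _ => j + 1 := rfl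
      -- Both coordinates expand with the same coefficients, those of c₁: in the second one, the
      -- recursion for p turns the phases of c₂ into those of c₁. Hence the span of the pairs at
      -- level j lies in that at level j + 1.
      have key : ((univ c₁).unit (fun _ => j) q r,
          ((p j q * (p j r)⁻¹ : Circle) : ℂ) • (univ c₂).unit (fun _ => j) q r) =
          ∑ α : Λ.PathTo q.1 fun _ => 1,
            ((c₁ q.2.2.1 α.2.1 *
              (c₁ r.2.2.1 (hqr ▸ α : Λ.PathTo r.1 fun _ => 1).2.1)⁻¹ : Circle) : ℂ) •
            ((univ c₁).unit (fun _ => j + 1) (q.extend hadd α) (r.extend hadd (hqr ▸ α)),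
              ((p (j + 1) (q.extend hadd α) * (p (j + 1) (r.extend hadd (hqr ▸ α)))⁻¹ : Circle) :
                ℂ) • (univ c₂).unit (fun _ => j + 1) (q.extend hadd α)
                  (r.extend hadd (hqr ▸ α))) := by
        refine Prod.ext ?_ ?_
        · rw [Prod.fst_sum]
          exact (univ c₁).unit_eq_sum hadd q r hqr
        · rw [Prod.snd_sum]
          dsimp only
          rw [(univ c₂).unit_eq_sum hadd q r hqr, Finset.smul_sum]
          refine Finset.sum_congr rfl fun α _ => ?_
          rw [Prod.smul_snd, smul_smul, smul_smul, hp, hp, ← Circle.coe_mul, ← Circle.coe_mul]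
          congr 2
          simp only [mul_inv, inv_inv]
          generalize c₁ q.2.2.1 α.2.1 = x
          generalize c₁ r.2.2.1 _ = y
          generalize c₂ q.2.2.1 α.2.1 = z
          generalize c₂ r.2.2.1 _ = t
          generalize p j q = a
          generalize (p j r)⁻¹ = b
          calc a * b * (z * t⁻¹) = a * b * (z * t⁻¹) * (x * x⁻¹) * (y * y⁻¹) := by
                rw [mul_inv_cancel, mul_inv_cancel, mul_one, mul_one]
            _ = _ := by ac_rfl
      rw [key]
      refine sum_mem fun α _ => SMulMemClass.smul_mem _ ?_
      exact (h (j + 1)).unit_mem_subalgebra (Set.mem_univ _) (Set.mem_univ _)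
    · rw [(h j).eq_zero q r hqr]
      exact zero_mem _
  have hfst : ∀ j, Prod.fst '' (W j : Set (CStar c₁ × CStar c₂)) =
      (univ c₁).level (fun _ => j) := fun j =>
    (h j).image_subalgebra (NonUnitalStarAlgHom.fst ℂ (CStar c₁) (CStar c₂)) Set.univ
  have hsnd : ∀ j, Prod.snd '' (W j : Set (CStar c₁ × CStar c₂)) =
      (univ c₂).level (fun _ => j) := fun j =>
    ((h j).image_subalgebra (NonUnitalStarAlgHom.snd ℂ (CStar c₁) (CStar c₂)) Set.univ).trans
      (congrArg _ (IsMatrixUnits.subalgebra_phase _ (p j) Set.univ))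
  have hne : ∀ (c : Λ.TwoCocycle) (n : Fin k → ℕ) (q : Λ.Path n), (univ c).unit n q q ≠ 0 :=
    fun c n q => (univ c).unit_self_ne_zero (univ_vertex_ne_zero c) n q
  have hnorm : ∀ w ∈ ⨆ j, W j, ‖w.1‖ = ‖w.2‖ := by
    intro w hw
    rw [← SetLike.mem_coe, NonUnitalStarSubalgebra.coe_iSup_of_directed hW.directed_le] at hw
    obtain ⟨j, hw⟩ := Set.mem_iUnion.1 hw
    have e₁ := (h j).norm_map_eq (NonUnitalStarAlgHom.fst ℂ (CStar c₁) (CStar c₂))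
      (fun q => hne c₁ _ q) hw
    have e₂ := (h j).norm_map_eq (NonUnitalStarAlgHom.snd ℂ (CStar c₁) (CStar c₂))
      (fun q => smul_ne_zero (Circle.coe_ne_zero _) (hne c₂ _ q)) hw
    exact e₁.trans e₂.symm
  obtain ⟨e, -⟩ := NonUnitalStarSubalgebra.exists_starAlgEquiv_of_norm_eq (⨆ j, W j) hnorm
    (fixedPoints c₁) (fixedPoints c₂)
    (by rw [NonUnitalStarSubalgebra.coe_iSup_of_directed hW.directed_le, Set.image_iUnion,
          ← closure_iUnion_level_diagonal]
        simp only [hfst])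
    (by rw [NonUnitalStarSubalgebra.coe_iSup_of_directed hW.directed_le, Set.image_iUnion,
          ← closure_iUnion_level_diagonal]
        simp only [hsnd])
  exact ⟨e⟩

end KGraph

/-! ### Matrix units in direct sums of algebras of compact operators -/

section directSum

theorem matrixUnit_apply {X : Type u} (x y : X) (f : lp (fun _ : X => ℂ) 2) :
    matrixUnit x y f = inner ℂ (lpBasis y) f • lpBasis x := by
  rw [matrixUnit, InnerProductSpace.rankOne_apply]
  rfl

theorem isMatrixUnits_matrixUnit (X : Type u) :
    IsMatrixUnits (fun _ : X => ()) fun x y : X => (CompactAlgebra.unit x y) where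
  star_eq x y := Subtype.ext (InnerProductSpace.adjoint_rankOne _ _)
  eq_zero x y h := absurd rfl h
  mul_eq x y z _ := Subtype.ext (ContinuousLinearMap.ext fun f => by
    change matrixUnit x y (matrixUnit y z f) = matrixUnit x z f
    rw [matrixUnit_apply, matrixUnit_apply, matrixUnit_apply, inner_smul_right,
      inner_self_eq_norm_sq_to_K, orthonormal_lpBasis.1]
    simp)
  mul_eq_zero x y z t h := Subtype.ext (ContinuousLinearMap.ext fun f => by
    change matrixUnit x y (matrixUnit z t f) = 0
    rw [matrixUnit_apply, matrixUnit_apply, inner_smul_right, orthonormal_lpBasis.2 h, mul_zero,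
      zero_smul])

theorem CompactAlgebra.unit_self_ne_zero {X : Type u} (x : X) : CompactAlgebra.unit x x ≠ 0 := by
  intro h
  have h1 : matrixUnit x x = 0 := congrArg Subtype.val h
  have h2 := congrArg (fun T => T (lpBasis x)) h1
  simp only [matrixUnit_apply] at h2
  rw [inner_self_eq_norm_sq_to_K, orthonormal_lpBasis.1] at h2
  simp only [map_one, one_pow, one_smul] at h2
  exact orthonormal_lpBasis.ne_zero x h2

theorem CompactAlgebra.mem_closure_subalgebra {X : Type u} (T : CompactAlgebra X) :
    T ∈ closure ((isMatrixUnits_matrixUnit X).subalgebra Set.univ : Set (CompactAlgebra X)) := by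
  refine (closure_subtype (x := (T : compactOperators X))).2 (closure_mono ?_ T.2)
  let ι : CompactAlgebra X →⋆ₙₐ[ℂ] _ := NonUnitalStarSubalgebraClass.subtype (compactOperators X)
  have h := (isMatrixUnits_matrixUnit X).image_subalgebra ι Set.univ
  have h' : NonUnitalStarAlgebra.adjoin ℂ {T | ∃ x y : X, T = matrixUnit x y} ≤
      ((isMatrixUnits_matrixUnit X).map ι).subalgebra Set.univ := by
    refine NonUnitalStarAlgebra.adjoin_le ?_
    rintro _ ⟨x, y, rfl⟩
    exact ((isMatrixUnits_matrixUnit X).map ι).unit_mem_subalgebra (Set.mem_univ x) (Set.mem_univ y)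
  intro x hx
  exact h.symm.subset (h' hx)

variable {I : Type u} (A : I → Type v) [∀ i, NonUnitalCStarAlgebra (A i)]

open scoped Classical in
/-- The inclusion of the `i`-th summand in a direct sum. -/
def CStarSum.singleHom (i : I) : A i →⋆ₙₐ[ℂ] CStarSum A where
  toFun := CStarSum.single A i
  map_smul' r a := Subtype.ext (lp.single_smul ∞ i r a)
  map_zero' := Subtype.ext (map_zero (lp.singleAddMonoidHom (E := A) ∞ i))
  map_add' a b := Subtype.ext (map_add (lp.singleAddMonoidHom (E := A) ∞ i) a b)
  map_mul' a b := Subtype.ext (lp.ext (funext fun j => by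
    change lp.single ∞ i (a * b) j = lp.single ∞ i a j * lp.single ∞ i b j
    by_cases h : j = i
    · subst h
      simp only [lp.single_apply_self]
    · simp only [lp.single_apply_ne _ _ _ h, mul_zero]))
  map_star' a := Subtype.ext (lp.ext (funext fun j => by
    change lp.single ∞ i (star a) j = star (lp.single ∞ i a j)
    by_cases h : j = i
    · subst h
      simp only [lp.single_apply_self]
    · simp only [lp.single_apply_ne _ _ _ h, star_zero]))

theorem CStarSum.single_mul_single_of_ne {i j : I} (h : i ≠ j) (a : A i) (b : A j) :
    CStarSum.single A i a * CStarSum.single A j b = 0 := by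
  classical
  refine Subtype.ext (lp.ext (funext fun l => ?_))
  change lp.single ∞ i a l * lp.single ∞ j b l = 0
  by_cases hl : l = i
  · rw [lp.single_apply_ne _ j _ (hl ▸ h), mul_zero]
  · rw [lp.single_apply_ne _ i _ hl, zero_mul]

theorem CStarSum.single_injective (i : I) : Function.Injective (CStarSum.single A i) := by
  classical
  intro a b h
  have h1 : lp.single ∞ i a = lp.single ∞ i b := congrArg Subtype.val h
  have h2 := congrArg (fun f : lp A ∞ => f i) h1
  simpa only [lp.single_apply_self] using h2

theorem CStarSum.mem_of_forall_single_mem (S : NonUnitalStarSubalgebra ℂ (CStarSum A))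
    [IsClosed (S : Set (CStarSum A))] (hS : ∀ i a, CStarSum.single A i a ∈ S) (x : CStarSum A) :
    x ∈ S := by
  classical
  have hcl : IsClosed (S : Set (CStarSum A)) := inferInstance
  rw [← SetLike.mem_coe, ← hcl.closure_eq, Metric.mem_closure_iff]
  intro ε hε
  have hx : Tendsto (fun i => ‖x.1 i‖) cofinite (𝓝 0) := x.2
  -- Outside this finite set the coordinates are smaller than ε / 2, so the finite partial sum
  -- approximates x in the supremum norm.
  have hfin : {i | ¬ ‖x.1 i‖ < ε / 2}.Finite :=
    eventually_cofinite.1 (hx.eventually_lt_const (half_pos hε))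
  refine ⟨∑ i ∈ hfin.toFinset, CStarSum.single A i (x.1 i), sum_mem fun i _ => hS i _, ?_⟩
  rw [dist_eq_norm]
  refine lt_of_le_of_lt ?_ (half_lt_self hε)
  change ‖(x - ∑ i ∈ hfin.toFinset, CStarSum.single A i (x.1 i)).1‖ ≤ ε / 2
  refine lp.norm_le_of_forall_le (half_pos hε).le fun j => ?_
  have h1 : (x - ∑ i ∈ hfin.toFinset, CStarSum.single A i (x.1 i)).1 j =
      x.1 j - ∑ i ∈ hfin.toFinset, lp.single ∞ i (x.1 i) j := by
    change (x.1 - (∑ i ∈ hfin.toFinset, CStarSum.single A i (x.1 i)).1) j = _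
    have h2 : (∑ i ∈ hfin.toFinset, CStarSum.single A i (x.1 i)).1 =
        ∑ i ∈ hfin.toFinset, lp.single ∞ i (x.1 i) :=
      AddSubmonoidClass.coe_finsetSum (S := vanishingFamilies A)
        (fun i => CStarSum.single A i (x.1 i)) _
    rw [h2, lp.coeFn_sub, Pi.sub_apply, lp.coeFn_sum, Finset.sum_apply]
  rw [h1]
  by_cases hj : j ∈ hfin.toFinset
  · rw [Finset.sum_eq_single j (fun i _ hi => lp.single_apply_ne _ _ _ hi.symm)
      (fun h => absurd hj h), lp.single_apply_self, sub_self, norm_zero]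
    exact (half_pos hε).le
  · rw [Finset.sum_eq_zero, sub_zero]
    · have := (not_congr hfin.mem_toFinset).1 hj
      exact (not_not.1 this).le
    · intro i hi
      exact lp.single_apply_ne _ _ _ fun h => hj (h ▸ hi)

end directSum

section directSumUnits

variable {I : Type u} (X : I → Type u)

open scoped Classical in
/-- The matrix units of the direct sum of the algebras `𝒦_{X i}`. -/
def CStarSum.unit (p q : Σ i, X i) : CStarSum fun i => CompactAlgebra (X i) :=
  if h : p.1 = q.1 then CStarSum.single _ q.1 (CompactAlgebra.unit (h ▸ p.2) q.2) else 0

theorem CStarSum.unit_mk (i : I) (x y : X i) : CStarSum.unit X ⟨i, x⟩ ⟨i, y⟩ =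
    CStarSum.single (fun i => CompactAlgebra (X i)) i (CompactAlgebra.unit x y) :=
  dif_pos rfl

theorem CStarSum.unit_of_ne {p q : Σ i, X i} (h : p.1 ≠ q.1) : CStarSum.unit X p q = 0 :=
  dif_neg h

theorem isMatrixUnits_cstarSum_unit :
    IsMatrixUnits (fun p : Σ i, X i => p.1) (CStarSum.unit X) where
  star_eq := by
    rintro ⟨i, x⟩ ⟨j, y⟩
    by_cases h : i = j
    · subst h
      rw [CStarSum.unit_mk, CStarSum.unit_mk, ← (isMatrixUnits_matrixUnit (X i)).star_eq x y]
      exact (map_star (CStarSum.singleHom (fun i => CompactAlgebra (X i)) i) _).symm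
    · rw [CStarSum.unit_of_ne X h, CStarSum.unit_of_ne X (Ne.symm h), star_zero]
  eq_zero p q h := CStarSum.unit_of_ne X h
  mul_eq := by
    rintro ⟨i, x⟩ ⟨j, y⟩ ⟨l, z⟩ h
    obtain rfl : i = j := h
    by_cases h : i = l
    · subst h
      rw [CStarSum.unit_mk, CStarSum.unit_mk, CStarSum.unit_mk,
        ← (isMatrixUnits_matrixUnit (X i)).mul_eq x y z rfl]
      exact (map_mul (CStarSum.singleHom (fun i => CompactAlgebra (X i)) i) _ _).symm
    · rw [CStarSum.unit_of_ne X (p := ⟨i, y⟩) (q := ⟨l, z⟩) h,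
        CStarSum.unit_of_ne X (p := ⟨i, x⟩) (q := ⟨l, z⟩) h, mul_zero]
  mul_eq_zero := by
    rintro ⟨i, x⟩ ⟨j, y⟩ ⟨l, z⟩ ⟨m, t⟩ hne
    by_cases h : i = j
    · subst h
      by_cases h' : l = m
      · subst h'
        rw [CStarSum.unit_mk, CStarSum.unit_mk]
        by_cases hil : i = l
        · subst hil
          have := (isMatrixUnits_matrixUnit (X i)).mul_eq_zero x y z t
            fun h => hne (congrArg (Sigma.mk i) h)
          have h2 := map_mul (CStarSum.singleHom (fun i => CompactAlgebra (X i)) i)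
            (CompactAlgebra.unit x y) (CompactAlgebra.unit z t)
          rw [this, map_zero] at h2
          exact h2.symm
        · exact CStarSum.single_mul_single_of_ne _ hil _ _
      · rw [CStarSum.unit_of_ne X (p := ⟨l, z⟩) h', mul_zero]
    · rw [CStarSum.unit_of_ne X (p := ⟨i, x⟩) h, zero_mul]

theorem CStarSum.unit_self_ne_zero (p : Σ i, X i) : CStarSum.unit X p p ≠ 0 := by
  obtain ⟨i, x⟩ := p
  rw [CStarSum.unit_mk]
  intro h
  refine CompactAlgebra.unit_self_ne_zero x
    (CStarSum.single_injective (fun i => CompactAlgebra (X i)) i ?_)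
  rw [h]
  exact (map_zero (CStarSum.singleHom (fun i => CompactAlgebra (X i)) i)).symm

/-- Each summand is the closed span of its own matrix units, and the summands together generate a
dense subalgebra of the c₀-sum. -/
theorem CStarSum.closure_subalgebra_unit :
    closure ((isMatrixUnits_cstarSum_unit X).subalgebra Set.univ :
      Set (CStarSum fun i => CompactAlgebra (X i))) = Set.univ := by
  let S := ((isMatrixUnits_cstarSum_unit X).subalgebra Set.univ).topologicalClosure
  have hS : IsClosed (S : Set (CStarSum fun i => CompactAlgebra (X i))) :=
    NonUnitalStarSubalgebra.isClosed_topologicalClosure _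
  refine Set.eq_univ_of_forall fun x => ?_
  refine CStarSum.mem_of_forall_single_mem _ S (fun i a => ?_) x
  let f := CStarSum.singleHom (fun i => CompactAlgebra (X i)) i
  have hcl : IsClosed {a | f a ∈ S} := hS.preimage f.continuous_of_cstar
  refine closure_minimal ?_ hcl (CompactAlgebra.mem_closure_subalgebra a)
  refine (isMatrixUnits_matrixUnit (X i)).subalgebra_le (S := S.comap f) fun x _ y _ => ?_
  change CStarSum.single (fun i => CompactAlgebra (X i)) i (CompactAlgebra.unit x y) ∈ S
  rw [← CStarSum.unit_mk]
  exact NonUnitalStarSubalgebra.le_topologicalClosure _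
    ((isMatrixUnits_cstarSum_unit X).unit_mem_subalgebra (Set.mem_univ _) (Set.mem_univ _))

/-- The closed span of nonzero matrix units with index set `Σ i, X i` is isomorphic to
`⨁ᵢ 𝒦_{X i}`. -/
theorem IsMatrixUnits.exists_starAlgEquiv_cstarSum {A : Type v} [NonUnitalCStarAlgebra A]
    {θ : (Σ i, X i) → (Σ i, X i) → A} (h₁ : IsMatrixUnits (fun p : Σ i, X i => p.1) θ)
    (hne : ∀ p, θ p p ≠ 0) :
    ∃ φ : (h₁.subalgebra Set.univ).topologicalClosure ≃⋆ₐ[ℂ]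
        CStarSum (fun i => CompactAlgebra (X i)),
      ∀ (i : I) (x y : X i) (h : θ ⟨i, x⟩ ⟨i, y⟩ ∈ (h₁.subalgebra Set.univ).topologicalClosure),
        φ ⟨θ ⟨i, x⟩ ⟨i, y⟩, h⟩ =
          CStarSum.single (fun i => CompactAlgebra (X i)) i (CompactAlgebra.unit x y) := by
  have h₂ := isMatrixUnits_cstarSum_unit X
  -- The pairs of corresponding units form matrix units in the product algebra, with both diagonal
  -- coordinates nonzero.
  have h := h₁.prodMk h₂
  have hnorm : ∀ w ∈ h.subalgebra Set.univ, ‖w.1‖ = ‖w.2‖ := fun w hw =>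
    (h.norm_map_eq (NonUnitalStarAlgHom.fst ℂ _ _) (fun q => hne q) hw).trans
    (h.norm_map_eq (NonUnitalStarAlgHom.snd ℂ _ _)
      (fun q => CStarSum.unit_self_ne_zero _ q) hw).symm
  obtain ⟨e, he⟩ := NonUnitalStarSubalgebra.exists_starAlgEquiv_of_norm_eq (h.subalgebra Set.univ)
    hnorm (h₁.subalgebra Set.univ).topologicalClosure ⊤
    (congrArg closure (h.image_subalgebra (NonUnitalStarAlgHom.fst ℂ _ _) Set.univ)).symm
    ((CStarSum.closure_subalgebra_unit X).symm.trans
      (congrArg closure (h.image_subalgebra (NonUnitalStarAlgHom.snd ℂ _ _) Set.univ)).symm)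
  let f : (⊤ : NonUnitalStarSubalgebra ℂ (CStarSum fun i => CompactAlgebra (X i))) →⋆ₙₐ[ℂ]
      (CStarSum fun i => CompactAlgebra (X i)) := NonUnitalStarSubalgebraClass.subtype _
  have hf : Function.Bijective f := ⟨Subtype.val_injective, fun x => ⟨⟨x, trivial⟩, rfl⟩⟩
  refine ⟨e.trans (StarAlgEquiv.ofBijective f hf), fun i x y hmem => ?_⟩
  have h3 := he _ (h.unit_mem_subalgebra (Set.mem_univ (⟨i, x⟩ : Σ i, X i))
    (Set.mem_univ ⟨i, y⟩)) hmem
  rw [StarAlgEquiv.trans_apply]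
  exact h3.trans (CStarSum.unit_mk X i x y)

end directSumUnits

/-! ### The isomorphism of a level with a direct sum of compact operators -/

namespace KGraph

variable {k : ℕ} {Λ : KGraph.{u} k} [Λ.RowFinite] (c : Λ.TwoCocycle)

/-- Sorting Λⁿ by source makes it, by definition, the disjoint union of the sets Λⁿv, so the general
statement on matrix units applies directly. -/
theorem exists_level_starAlgEquiv [Λ.NoSources] (n : Fin k → ℕ) :
    ∃ φ : ((univ c).level n).topologicalClosure ≃⋆ₐ[ℂ]
        CStarSum (fun v : Λ.Obj => CompactAlgebra (Λ.PathFrom n v)),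
      ∀ (v : Λ.Obj) (μ ν : Λ.PathFrom n v)
        (h : univ c μ.2.1 * star (univ c ν.2.1) ∈ ((univ c).level n).topologicalClosure),
        φ ⟨univ c μ.2.1 * star (univ c ν.2.1), h⟩ =
          CStarSum.single (fun v : Λ.Obj => CompactAlgebra (Λ.PathFrom n v)) v
            (CompactAlgebra.unit μ ν) :=
  IsMatrixUnits.exists_starAlgEquiv_cstarSum (Λ.PathFrom n) ((univ c).isMatrixUnits_unit n)
    ((univ c).unit_self_ne_zero (univ_vertex_ne_zero c) n)

/-- Units whose sources differ are zero, so agreement on the units with a common source gives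
agreement on the dense span, and continuity does the rest. -/
theorem level_starAlgEquiv_ext (n : Fin k → ℕ) {B : Type w} [NonUnitalCStarAlgebra B]
    (φ ψ : ((univ c).level n).topologicalClosure ≃⋆ₐ[ℂ] B)
    (h : ∀ (v : Λ.Obj) (μ ν : Λ.PathFrom n v)
      (h : univ c μ.2.1 * star (univ c ν.2.1) ∈ ((univ c).level n).topologicalClosure),
      φ ⟨univ c μ.2.1 * star (univ c ν.2.1), h⟩ = ψ ⟨univ c μ.2.1 * star (univ c ν.2.1), h⟩) :
    φ = ψ := by
  let D := ((univ c).level n).topologicalClosure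
  have hD : IsClosed (D : Set (CStar c)) := NonUnitalStarSubalgebra.isClosed_topologicalClosure _
  let φ' : D →⋆ₙₐ[ℂ] B := φ.toNonUnitalStarAlgHom
  let ψ' : D →⋆ₙₐ[ℂ] B := ψ.toNonUnitalStarAlgHom
  let M : NonUnitalStarSubalgebra ℂ (CStar c) :=
    (NonUnitalStarAlgHom.equalizer φ' ψ').map (NonUnitalStarSubalgebraClass.subtype D)
  have hM : (univ c).level n ≤ M := by
    refine ((univ c).isMatrixUnits_unit n).subalgebra_le ?_
    rintro ⟨v, μ⟩ - ⟨v', ν⟩ -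
    by_cases hv : v = v'
    · subst hv
      exact ⟨⟨_, NonUnitalStarSubalgebra.le_topologicalClosure _
        ((univ c).unit_mem_level n ⟨v, μ⟩ ⟨v, ν⟩)⟩, h v μ ν _, rfl⟩
    · rw [((univ c).isMatrixUnits_unit n).eq_zero ⟨v, μ⟩ ⟨v', ν⟩ hv]
      exact zero_mem _
  have hdense : Dense {x : D | φ' x = ψ' x} := by
    intro x
    rw [closure_subtype]
    refine closure_mono (fun y hy => ?_) x.2
    obtain ⟨z, hz, rfl⟩ := hM hy
    exact ⟨z, hz, rfl⟩
  have := Continuous.ext_on hdense φ'.continuous_of_cstar ψ'.continuous_of_cstar fun x hx => hx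
  exact StarAlgEquiv.ext fun x => congrFun this x

end KGraph

end

theorem mainTheorem12 {k : ℕ} (Λ : KGraph.{u} k) [Λ.RowFinite] [Λ.NoSources] :
    (∀ c : Λ.TwoCocycle,
      -- the closed span at level `n` is a C⋆-subalgebra of the fixed-point algebra, and
      -- `s_μ s_ν* ↦ θ_{μ,ν}` determines an isomorphism onto `⨁_v 𝒦_{Λⁿv}`
      (∀ n : Fin k → ℕ, ∃ D : NonUnitalStarSubalgebra ℂ (KGraph.CStar c),
        (D : Set (KGraph.CStar c)) = closure (KGraph.levelSpan c n : Set (KGraph.CStar c)) ∧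
        D ≤ KGraph.fixedPoints c ∧
        ∃! φ : D ≃⋆ₐ[ℂ] CStarSum (fun v : Λ.Obj => CompactAlgebra (Λ.PathFrom n v)),
          ∀ (v : Λ.Obj) (μ ν : Λ.PathFrom n v)
            (h : KGraph.univ c μ.2.1 * star (KGraph.univ c ν.2.1) ∈ D),
            φ ⟨KGraph.univ c μ.2.1 * star (KGraph.univ c ν.2.1), h⟩ =
              CStarSum.single (fun v : Λ.Obj => CompactAlgebra (Λ.PathFrom n v)) v
                (CompactAlgebra.unit μ ν)) ∧
      -- these subalgebras increase with `n`, their union is dense in the fixed-point algebra,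
      -- and the fixed-point algebra is AF
      (∀ m n : Fin k → ℕ, m ≤ n →
        closure (KGraph.levelSpan c m : Set (KGraph.CStar c)) ⊆
          closure (KGraph.levelSpan c n : Set (KGraph.CStar c))) ∧
      (KGraph.fixedPoints c : Set (KGraph.CStar c)) =
        closure (⋃ n : Fin k → ℕ, (KGraph.levelSpan c n : Set (KGraph.CStar c))) ∧
      IsAF (KGraph.fixedPoints c) ∧
      -- injectivity of `π_t` on the fixed-point algebra
      (∀ (B : Type w) [NonUnitalCStarAlgebra B] (t : KGraph.CKFamily c B),
        Set.InjOn (KGraph.lift t) (KGraph.fixedPoints c) ↔ ∀ v : Λ.Obj, t (𝟙 v) ≠ 0)) ∧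
    -- independence of the cocycle
    (∀ c₁ c₂ : Λ.TwoCocycle,
      Nonempty (KGraph.fixedPoints c₁ ≃⋆ₐ[ℂ] KGraph.fixedPoints c₂)) := by
  refine ⟨fun c => ⟨fun n => ?_, fun m n h => ?_, ?_, KGraph.isAF_fixedPoints c,
    fun B _ t => KGraph.injOn_lift_iff t⟩, KGraph.nonempty_fixedPoints_starAlgEquiv⟩
  · refine ⟨((KGraph.univ c).level n).topologicalClosure, ?_, ?_, ?_⟩
    · rw [KGraph.coe_levelSpan]
      rfl
    · exact NonUnitalStarSubalgebra.topologicalClosure_minimal _ (KGraph.level_le_fixedPoints c n)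
        inferInstance
    · obtain ⟨φ, hφ⟩ := KGraph.exists_level_starAlgEquiv c n
      refine ⟨φ, hφ, fun ψ hψ => KGraph.level_starAlgEquiv_ext c n ψ φ fun v μ ν h => ?_⟩
      rw [hφ, hψ]
  · rw [KGraph.coe_levelSpan, KGraph.coe_levelSpan]
    exact closure_mono ((KGraph.univ c).level_mono h)
  · rw [KGraph.fixedPoints_eq_closure]
    simp only [KGraph.coe_levelSpan]
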